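/- Let $\mathcal G=(\mathcal V,\mathcal E,w)$ be a connected undirected graph with $n$ nodes and positive link weights $w$, let $L=\Delta-A$ be its weighted Laplacian, and let $\tau\ge 0$ be such that $\tau\lambda<\pi/2$ for every eigenvalue $\lambda$ of $L$. Let $I$ be a finite set of noise channels ($I=\mathcal V$ for noise on the nodes, $I=\mathcal E$ for noise on the links), let $B\in\mathbb R^{\mathcal V\times I}$, and let $\xi=(\xi_k)_{k\in I}$ be independent zero-mean Gaussian white noises with intensities $\sigma_k^2$, $\sigma_k\ge 0$, i.e. $\xi_k=\sigma_k\,dW_k/dt$ for independent standard Brownian motions $W_k$. Consider the delay consensus network $$\dot x(t)=-L\,x(t-\tau)+B\,\xi(t),\qquad y(t)=M_n\,x(t),$$ with $x(t)=0$ for $t\in[-\tau,0)$ and $x(0)=x^0\in\mathbb R^{\mathcal V}$, the dynamics being understood in integrated form, $x(t)=x^0-\int_0^tL\,x(s-\tau)\,ds+B\,(\sigma_kW_k(t))_{k\in I}$ for $t\ge0$. Here $M_n=I_n-\frac1nJ_n$, where $J_n$ is the all-ones matrix. Then the steady-state performance $$\rho_{ss}=\lim_{t\to\infty}\mathbb E\big[y(t)^{T}y(t)\big]$$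 exists, is finite, and satisfies $$\rho_{ss}=\sum_{k\in I}\eta_k\,\sigma_k^2,\qquad \eta_k=\tfrac12\Big[B^{T}L^{\dagger}\cos(\tau L)\big(M_n-\sin(\tau L)\big)^{\dagger}B\Big]_{kk},$$ where $\dagger$ is the Moore–Penrose pseudo-inverse and $\cos,\sin$ of a matrix are given by their power series. The coefficients are the centralities of the noise channels: $\eta_k=\partial\rho_{ss}/\partial(\sigma_k^2)$ (one-sided at $\sigma_k=0$). For $I=\mathcal E$ the coefficient $\eta_e$ is denoted $\nu_e$. Moreover, for every orthogonal matrix $Q$ with $L=Q\,\mathrm{diag}(\lambda_1,\dots,\lambda_n)\,Q^{T}$, $$\rho_{ss}=\sum_{i:\ \lambda_i\neq0}\frac{b_i}{2\lambda_i}\,\frac{\cos(\lambda_i\tau)}{1-\sin(\lambda_i\tau)},\qquad b_i=\big[Q^{T}\hat B\hat B^{T}Q\big]_{ii},\quad \hat B=B\,\mathrm{diag}(\sigma_k)_{k\in I}.$$ -/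

import Mathlib

open MeasureTheory ProbabilityTheory Filter Topology
open scoped NNReal Matrix

noncomputable section

namespace DelayConsensus

/-! ### Moore–Penrose pseudo-inverse of a real matrix -/

/-- The four Penrose equations: `P` is a Moore–Penrose pseudo-inverse of `A`. -/
structure IsMoorePenrose {m n : Type*} [Fintype m] [Fintype n]
    (A : Matrix m n ℝ) (P : Matrix n m ℝ) : Prop where
  mul_mul_left : A * P * A = A
  mul_mul_right : P * A * P = P
  symm_left : (A * P)ᵀ = A * P
  symm_right : (P * A)ᵀ = P * A

/-- The Moore–Penrose pseudo-inverse is unique. -/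
theorem IsMoorePenrose.unique {m n : Type*} [Fintype m] [Fintype n]
    {A : Matrix m n ℝ} {P R : Matrix n m ℝ}
    (hP : IsMoorePenrose A P) (hR : IsMoorePenrose A R) : P = R := by
  have h1 : A * P = A * R := by
    calc A * P = (A * P)ᵀ := hP.symm_left.symm
      _ = ((A * R) * (A * P))ᵀ := by
          rw [← Matrix.mul_assoc (A * R) A P, hR.mul_mul_left]
      _ = (A * P) * (A * R) := by
          rw [Matrix.transpose_mul, hP.symm_left, hR.symm_left]
      _ = A * R := by rw [← Matrix.mul_assoc, hP.mul_mul_left]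
  have h2 : P * A = R * A := by
    calc P * A = (P * A)ᵀ := hP.symm_right.symm
      _ = ((P * A) * (R * A))ᵀ := by
          rw [Matrix.mul_assoc P A (R * A), ← Matrix.mul_assoc A R A, hR.mul_mul_left]
      _ = (R * A) * (P * A) := by
          rw [Matrix.transpose_mul, hP.symm_right, hR.symm_right]
      _ = R * A := by rw [Matrix.mul_assoc, ← Matrix.mul_assoc A P A, hP.mul_mul_left]
  calc P = P * A * P := hP.mul_mul_right.symm
    _ = R * A * R := by rw [h2, Matrix.mul_assoc, h1, ← Matrix.mul_assoc]
    _ = R := hR.mul_mul_right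

/-- The pseudo-inverse of an orthogonally diagonalised matrix. -/
theorem isMoorePenrose_of_diag {n : Type*} [Fintype n] [DecidableEq n]
    (Q : Matrix n n ℝ) (d : n → ℝ) (hQ : Qᵀ * Q = 1) :
    IsMoorePenrose (Q * Matrix.diagonal d * Qᵀ)
      (Q * Matrix.diagonal (fun i => (d i)⁻¹) * Qᵀ) := by
  have key : ∀ a b : n → ℝ, (Q * Matrix.diagonal a * Qᵀ) * (Q * Matrix.diagonal b * Qᵀ)
      = Q * Matrix.diagonal (fun i => a i * b i) * Qᵀ := by
    intro a b
    calc (Q * Matrix.diagonal a * Qᵀ) * (Q * Matrix.diagonal b * Qᵀ)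
        = Q * Matrix.diagonal a * (Qᵀ * Q) * Matrix.diagonal b * Qᵀ := by
          simp only [Matrix.mul_assoc]
      _ = _ := by
          rw [hQ, Matrix.mul_one, Matrix.mul_assoc Q, Matrix.diagonal_mul_diagonal]
  have hs : ∀ a : n → ℝ, (Q * Matrix.diagonal a * Qᵀ)ᵀ = Q * Matrix.diagonal a * Qᵀ := by
    intro a
    simp [Matrix.transpose_mul, Matrix.mul_assoc]
  refine ⟨?_, ?_, ?_, ?_⟩
  · rw [key, key]
    congr 3
    funext i
    exact mul_inv_mul_cancel (d i)
  · rw [key, key]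
    congr 3
    funext i
    by_cases h : d i = 0 <;> simp [h]
  · rw [key, hs]
  · rw [key, hs]

/-- Every real matrix has a Moore–Penrose pseudo-inverse. -/
theorem exists_isMoorePenrose {m n : Type*} [Fintype m] [Fintype n]
    (A : Matrix m n ℝ) : ∃ P, IsMoorePenrose A P := by
  classical
  have hS : (Aᵀ * A).IsHermitian := by
    simpa using Matrix.isHermitian_conjTranspose_mul_self A
  obtain ⟨K, hK⟩ : ∃ K, IsMoorePenrose (Aᵀ * A) K := by
    have h := hS.spectral_theorem
    have hU : ((hS.eigenvectorUnitary : Matrix n n ℝ))ᵀ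
        * (hS.eigenvectorUnitary : Matrix n n ℝ) = 1 := by
      have := (Matrix.mem_unitaryGroup_iff'.1 hS.eigenvectorUnitary.2)
      simpa [Matrix.star_eq_conjTranspose] using this
    have h' : Aᵀ * A = (hS.eigenvectorUnitary : Matrix n n ℝ)
        * Matrix.diagonal hS.eigenvalues * ((hS.eigenvectorUnitary : Matrix n n ℝ))ᵀ := by
      rw [Unitary.conjStarAlgAut_apply] at h
      simpa [Matrix.star_eq_conjTranspose, Function.comp_def] using h
    rw [h']
    exact ⟨_, isMoorePenrose_of_diag _ _ hU⟩
  have hSs : (Aᵀ * A)ᵀ = Aᵀ * A := by simp [Matrix.transpose_mul]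
  have hK' : IsMoorePenrose (Aᵀ * A) Kᵀ := by
    refine ⟨?_, ?_, ?_, ?_⟩
    · have := congrArg Matrix.transpose hK.mul_mul_left
      simpa [Matrix.transpose_mul, Matrix.mul_assoc] using this
    · have := congrArg Matrix.transpose hK.mul_mul_right
      simpa [Matrix.transpose_mul, Matrix.mul_assoc] using this
    · have := hK.symm_right
      rw [Matrix.transpose_mul, hSs] at this
      rw [Matrix.transpose_mul, hSs, Matrix.transpose_transpose, this]
    · have := hK.symm_left
      rw [Matrix.transpose_mul, hSs] at this
      rw [Matrix.transpose_mul, hSs, Matrix.transpose_transpose, this]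
  have hKs : Kᵀ = K := hK'.unique hK
  have hAKS : A * K * (Aᵀ * A) = A := by
    have h0 : (A * K * (Aᵀ * A) - A)ᵀ * (A * K * (Aᵀ * A) - A) = 0 := by
      have e : (A * K * (Aᵀ * A) - A)ᵀ * (A * K * (Aᵀ * A) - A)
          = (Aᵀ * A * K - 1) * ((Aᵀ * A) * K * (Aᵀ * A) - Aᵀ * A) := by
        simp only [Matrix.transpose_sub, Matrix.transpose_mul, Matrix.transpose_transpose, hKs,
          Matrix.mul_sub, Matrix.sub_mul, Matrix.mul_assoc, Matrix.one_mul]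
      rw [e, hK.mul_mul_left, sub_self, Matrix.mul_zero]
    have := Matrix.conjTranspose_mul_self_eq_zero.1
      (show (A * K * (Aᵀ * A) - A)ᴴ * (A * K * (Aᵀ * A) - A) = 0 by simpa using h0)
    exact sub_eq_zero.1 this
  refine ⟨K * Aᵀ, ?_, ?_, ?_, ?_⟩
  · simpa [Matrix.mul_assoc] using hAKS
  · have := hK.mul_mul_right
    calc K * Aᵀ * A * (K * Aᵀ) = (K * (Aᵀ * A) * K) * Aᵀ := by simp only [Matrix.mul_assoc]
      _ = K * Aᵀ := by rw [this]
  · simp [Matrix.transpose_mul, hKs, Matrix.mul_assoc]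
  · have := hK.symm_right
    simpa [Matrix.mul_assoc] using this

/-- The Moore–Penrose pseudo-inverse `A†` of a real matrix `A`. -/
def pinv {m n : Type*} [Fintype m] [Fintype n] (A : Matrix m n ℝ) : Matrix n m ℝ :=
  Classical.choose (exists_isMoorePenrose A)

theorem pinv_spec {m n : Type*} [Fintype m] [Fintype n] (A : Matrix m n ℝ) :
    IsMoorePenrose A (pinv A) :=
  Classical.choose_spec (exists_isMoorePenrose A)

/-! ### Matrix cosine and sine, centering matrix, weighted Laplacian -/

/-- `cos X = ∑ₖ (-1)ᵏ X²ᵏ / (2k)!`. -/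
def matCos {n : Type*} [Fintype n] [DecidableEq n] (X : Matrix n n ℝ) : Matrix n n ℝ :=
  ∑' k : ℕ, ((-1 : ℝ) ^ k / ((2 * k).factorial : ℝ)) • X ^ (2 * k)

/-- `sin X = ∑ₖ (-1)ᵏ X²ᵏ⁺¹ / (2k+1)!`. -/
def matSin {n : Type*} [Fintype n] [DecidableEq n] (X : Matrix n n ℝ) : Matrix n n ℝ :=
  ∑' k : ℕ, ((-1 : ℝ) ^ k / ((2 * k + 1).factorial : ℝ)) • X ^ (2 * k + 1)

/-- The centering matrix `Mₙ = I - (1/n) J`, with `J` the all-ones matrix and `n = |V|`. -/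
def centering (V : Type*) [Fintype V] [DecidableEq V] : Matrix V V ℝ :=
  1 - (1 / (Fintype.card V : ℝ)) • Matrix.of (fun _ _ : V => (1 : ℝ))

open Classical in
/-- The adjacency matrix of the graph `G` with link weights `w`. -/
def weightedAdj {V : Type*} (G : SimpleGraph V) (w : Sym2 V → ℝ) : Matrix V V ℝ :=
  Matrix.of fun i j => if G.Adj i j then w s(i, j) else 0

/-- The Laplacian `L = Δ - A` of the weighted graph `(G, w)`, with `Δ` the diagonal matrix of
weighted node degrees. -/
def laplacian {V : Type*} [Fintype V] [DecidableEq V] (G : SimpleGraph V) (w : Sym2 V → ℝ) :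
    Matrix V V ℝ :=
  Matrix.diagonal (fun i => ∑ j, weightedAdj G w i j) - weightedAdj G w

/-! ### The noisy delay network -/

/-- A family of independent standard Brownian motions. White noise `ξ` with independent components
of intensities `σₖ²` is the formal time derivative of the process `(σₖ Wₖ)ₖ`. -/
structure IsIndepBrownian {ι Ω : Type*} [MeasurableSpace Ω]
    (W : ι → ℝ≥0 → Ω → ℝ) (P : Measure Ω) : Prop where
  brownian : ∀ k, IsBrownianReal (W k) P
  indep : iIndepFun (fun k ω t => W k t ω) P

/-- `X` is the state of `dx/dt = -L x(t-τ) + B ξ(t)`, with `x = 0` on `[-τ, 0)` and `x(0) = x₀`,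
driven by the white noise `ξ = (σₖ dWₖ/dt)ₖ`. The noise being additive, the equation is
understood in its integrated form, path by path. -/
structure IsNetworkState {V ι Ω : Type*} [Fintype V] [Fintype ι] [MeasurableSpace Ω]
    (L : Matrix V V ℝ) (τ : ℝ) (B : Matrix V ι ℝ) (σ : ι → ℝ) (x₀ : V → ℝ)
    (W : ι → ℝ≥0 → Ω → ℝ) (P : Measure Ω) (X : ℝ → Ω → V → ℝ) : Prop where
  aemeasurable : ∀ t, -τ ≤ t → AEMeasurable (X t) P
  history : ∀ᵐ ω ∂P, ∀ t ∈ Set.Ico (-τ) 0, X t ω = 0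
  continuousOn : ∀ᵐ ω ∂P, ContinuousOn (fun t => X t ω) (Set.Ici 0)
  equation : ∀ᵐ ω ∂P, ∀ t, 0 ≤ t → ∀ i,
    X t ω i = x₀ i - (∫ s in (0 : ℝ)..t, (L *ᵥ X (s - τ) ω) i)
      + (B *ᵥ fun k => σ k * W k t.toNNReal ω) i

/-- The squared norm `yᵀ y` of the output `y(t) = Mₙ x(t)`. -/
def outputSq {V Ω : Type*} [Fintype V] [DecidableEq V] (X : ℝ → Ω → V → ℝ) (t : ℝ) (ω : Ω) : ℝ :=
  (centering V *ᵥ X t ω) ⬝ᵥ (centering V *ᵥ X t ω)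

/-- The steady-state performance `ρ_ss = lim_{t → ∞} E[y(t)ᵀ y(t)]`. -/
def rhoSS {V Ω : Type*} [Fintype V] [DecidableEq V] [MeasurableSpace Ω]
    (P : Measure Ω) (X : ℝ → Ω → V → ℝ) : ℝ :=
  limUnder atTop (fun t => ∫ ω, outputSq X t ω ∂P)

/-- `c` is the centrality `∂ρ/∂(σₖ²)` of the noise channel `k`, at the noise levels `σ`, for a
performance `ρ` given as a function of the noise levels (standard deviations). The variance `σₖ²`
ranges over `[0, ∞)`, so the derivative is one-sided at `σₖ = 0`. -/
def HasCentrality {ι : Type*} [DecidableEq ι] (ρ : (ι → ℝ) → ℝ) (k : ι) (σ : ι → ℝ) (c : ℝ) :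
    Prop :=
  HasDerivWithinAt (fun v : ℝ => ρ (Function.update σ k (Real.sqrt v))) c (Set.Ici 0) (σ k ^ 2)

/-- The diagonal entry `½ [Bᵀ L† cos(τL) (Mₙ - sin(τL))† B]ₖₖ`. -/
def centralityIndex {V ι : Type*} [Fintype V] [DecidableEq V]
    (L : Matrix V V ℝ) (τ : ℝ) (B : Matrix V ι ℝ) (k : ι) : ℝ :=
  (1 / 2) * (Bᵀ * pinv L * matCos (τ • L) * pinv (centering V - matSin (τ • L)) * B) k k

end DelayConsensus

end

namespace DelayConsensus

/-! In an orthonormal eigenbasis of the Laplacian the network splits into scalar equations `z(t) =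
z₀ - lam ∫₀ᵗ z(s-τ) ds + N(t)`, where `N` has the covariance of a Brownian motion of intensity `b =
∑ₖ ((Qᵀ B)ᵢₖ σₖ)²`. Since the graph is connected, centering removes exactly the zero modes, so `E[yᵀ
y]` is the sum of `E[z²]` over the nonzero ones (`outputSq_eq`).

With `φ` the fundamental solution, variation of constants reads `z(t) = φ(t) z₀ + ∫₀ᵗ φ(t-s) dN(s)`.
The Wiener integral is written after integration by parts, so only ordinary path integrals occur and
only the second-order structure of `N` matters: `E[z²] = φ² z₀² + b ∫₀ᵗ φ²`
(`IsBrownianLike.secondMoment`). It remains to prove `φ → 0` and to compute `∫₀^∞ φ²`.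

Rescaling time gives unit gain and delay `T = lam τ < π/2`. No transform is used. The
autocorrelation `U(s) = ∫₀^∞ x(u) x(u+s) du` should satisfy `U'(s) = -U(T-s)` and `U'(0+) = -1/2`,
hence `U'' = -U` and `U(s) = A cos s - sin s / 2` on `[0, T]`, with `A = cos T / (2 (1 - sin T))`.
The quadratic form `V` with kernel `U(|a-b|)` (`lyapunov`) satisfies `V' = -x²` and `V(0) = A`. It
is nonnegative for `T < π/2` (`lyapunov_nonneg`), so `x²` is integrable. This forces `x → 0`, then
`V → 0`, and `∫₀^∞ x² = A` exactly.

Finally, `L†`, `cos (τL)` and `(Mₙ - sin (τL))†` are all diagonal in the eigenbasis, which turns the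
modal sum into the indices; the performance is then affine in each `σₖ²`. -/

/-! ### Causal functions -/

/-- A function vanishing on the negative half-line and continuous on the nonnegative one. -/
structure IsCausal (f : ℝ → ℝ) : Prop where
  neg : ∀ t, t < 0 → f t = 0
  cont : ContinuousOn f (Set.Ici 0)

namespace IsCausal

variable {f : ℝ → ℝ}

/-- Freezing the argument at `0` removes the possible jump there. Measurability and integrability
are inherited from this continuous function through an indicator. -/
theorem continuous_max (hf : IsCausal f) : Continuous fun t => f (max t 0) :=
  hf.cont.comp_continuous (by fun_prop) fun _ => Set.mem_Ici.2 (le_max_right _ _)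

theorem eq_indicator (hf : IsCausal f) :
    f = (Set.Ici (0 : ℝ)).indicator fun t => f (max t 0) := by
  funext t
  by_cases h : 0 ≤ t
  · simp [h]
  · simp [h, hf.neg t (not_le.1 h)]

theorem measurable (hf : IsCausal f) : Measurable f := by
  rw [hf.eq_indicator]
  exact hf.continuous_max.measurable.indicator measurableSet_Ici

theorem intervalIntegrable (hf : IsCausal f) (a b : ℝ) : IntervalIntegrable f volume a b := by
  rw [hf.eq_indicator, intervalIntegrable_iff]
  exact (intervalIntegrable_iff.1 (hf.continuous_max.intervalIntegrable a b)).indicator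
    measurableSet_Ici

theorem intervalIntegrable_comp_sub (hf : IsCausal f) (c a b : ℝ) :
    IntervalIntegrable (fun s => f (s - c)) volume a b := by
  simpa using (hf.intervalIntegrable (a - c) (b - c)).comp_sub_right c

theorem intervalIntegrable_comp_const_sub (hf : IsCausal f) (c a b : ℝ) :
    IntervalIntegrable (fun s => f (c - s)) volume a b := by
  simpa using (hf.intervalIntegrable (c - a) (c - b)).comp_sub_left c

theorem continuousAt (hf : IsCausal f) {t : ℝ} (ht : t ≠ 0) : ContinuousAt f t := by
  rcases lt_or_gt_of_ne ht with h | h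
  · refine (continuousAt_const (y := (0 : ℝ))).congr ?_
    filter_upwards [Iio_mem_nhds h] with s hs
    exact (hf.neg s hs).symm
  · exact hf.cont.continuousAt (Ici_mem_nhds h)

theorem continuousOn_uIcc (hf : IsCausal f) {t : ℝ} (ht : 0 ≤ t) :
    ContinuousOn f (Set.uIcc 0 t) :=
  hf.cont.mono fun s hs => by
    rw [Set.uIcc_of_le ht] at hs
    exact hs.1

theorem mul_continuous (hf : IsCausal f) {g : ℝ → ℝ} (hg : Continuous g) :
    IsCausal fun t => f t * g t :=
  ⟨fun t ht => by simp [hf.neg t ht], hf.cont.mul hg.continuousOn⟩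

theorem exists_bound (hf : IsCausal f) (R : ℝ) : ∃ K, 0 ≤ K ∧ ∀ t ≤ R, |f t| ≤ K := by
  obtain ⟨K, hK⟩ := (isCompact_Icc (a := (0 : ℝ)) (b := R)).exists_bound_of_continuousOn
    (hf.cont.mono Set.Icc_subset_Ici_self)
  refine ⟨max K 0, le_max_right _ _, fun t ht => ?_⟩
  by_cases h : 0 ≤ t
  · exact (hK t ⟨h, ht⟩).trans (le_max_left _ _)
  · simp [hf.neg t (not_le.1 h)]

theorem continuous_primitive (hf : IsCausal f) : Continuous fun t => ∫ s in (0 : ℝ)..t, f s :=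
  intervalIntegral.continuous_primitive (fun a b => hf.intervalIntegrable a b) 0

theorem continuous_primitive_comp_sub (hf : IsCausal f) (c : ℝ) :
    Continuous fun t => ∫ s in (0 : ℝ)..t, f (s - c) :=
  intervalIntegral.continuous_primitive (fun a b => hf.intervalIntegrable_comp_sub c a b) 0

theorem hasDerivAt_primitive_comp_sub (hf : IsCausal f) (c : ℝ) {t : ℝ} (ht : t ≠ c) :
    HasDerivAt (fun t => ∫ s in (0 : ℝ)..t, f (s - c)) (f (t - c)) t := by
  refine intervalIntegral.integral_hasDerivAt_right (hf.intervalIntegrable_comp_sub c 0 t)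
    (Measurable.stronglyMeasurable ?_).stronglyMeasurableAtFilter ?_
  · exact hf.measurable.comp (by fun_prop)
  · exact ContinuousAt.comp (f := fun s : ℝ => s - c) (hf.continuousAt (sub_ne_zero.2 ht))
      (by fun_prop)

theorem hasDerivAt_primitive (hf : IsCausal f) {t : ℝ} (ht : t ≠ 0) :
    HasDerivAt (fun t => ∫ s in (0 : ℝ)..t, f s) (f t) t := by
  simpa using hf.hasDerivAt_primitive_comp_sub 0 ht

theorem primitive_of_nonpos (hf : IsCausal f) {t : ℝ} (ht : t ≤ 0) :
    ∫ s in (0 : ℝ)..t, f s = 0 := by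
  rw [intervalIntegral.integral_symm, neg_eq_zero]
  refine intervalIntegral.integral_zero_ae ?_
  have : ∀ᵐ s : ℝ, s ≠ 0 := by simp [ae_iff]
  filter_upwards [this] with s hs hs'
  rw [Set.uIoc_of_le ht] at hs'
  exact hf.neg s (lt_of_le_of_ne hs'.2 hs)

end IsCausal

/-! ### The fundamental solution of the scalar delay equation -/

/-- `φ` is the fundamental solution of `ż(t) = -lam z(t - τ)`. -/
structure IsFundamental (lam τ : ℝ) (φ : ℝ → ℝ) : Prop extends IsCausal φ where
  equation : ∀ t, 0 ≤ t → φ t = 1 - lam * ∫ s in (0 : ℝ)..t, φ (s - τ)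

namespace IsFundamental

variable {lam τ : ℝ} {φ : ℝ → ℝ}

theorem zero (hφ : IsFundamental lam τ φ) : φ 0 = 1 := by
  simpa using hφ.equation 0 le_rfl

theorem hasDerivAt (hφ : IsFundamental lam τ φ) {t : ℝ} (ht : 0 < t) (htτ : t ≠ τ) :
    HasDerivAt φ (-lam * φ (t - τ)) t := by
  have h := ((hφ.toIsCausal.hasDerivAt_primitive_comp_sub τ htτ).const_mul lam).const_sub 1
  rw [neg_mul]
  refine h.congr_of_eventuallyEq ?_
  filter_upwards [Ioi_mem_nhds ht] with s hs
  exact hφ.equation s (le_of_lt hs)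

end IsFundamental

/-- The `k`-th term `(-lam)ᵏ (t - kτ)₊ᵏ / k!` of the series for the fundamental solution. -/
noncomputable def fundamentalTerm (lam τ : ℝ) (k : ℕ) (t : ℝ) : ℝ :=
  if (k : ℝ) * τ ≤ t then (-lam) ^ k / (k.factorial : ℝ) * (t - k * τ) ^ k else 0

theorem measurable_fundamentalTerm (lam τ : ℝ) (k : ℕ) :
    Measurable (fundamentalTerm lam τ k) :=
  Measurable.ite measurableSet_Ici (by fun_prop) measurable_const

theorem abs_fundamentalTerm_le {τ : ℝ} (hτ : 0 ≤ τ) (lam : ℝ) (k : ℕ) {t R : ℝ} (ht : t ≤ R) :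
    |fundamentalTerm lam τ k t| ≤ (|lam| * |R|) ^ k / (k.factorial : ℝ) := by
  unfold fundamentalTerm
  have hk : 0 ≤ (k : ℝ) * τ := by positivity
  split_ifs with h
  · rw [abs_mul, abs_div, abs_pow, abs_neg, abs_pow, mul_pow, Nat.abs_cast,
      abs_of_nonneg (sub_nonneg.2 h), div_mul_eq_mul_div]
    have : t - k * τ ≤ |R| := by
      have := le_abs_self R
      linarith
    have h0 : 0 ≤ t - k * τ := sub_nonneg.2 h
    gcongr
  · rw [abs_zero]
    positivity

theorem summable_fundamentalTerm {τ : ℝ} (hτ : 0 ≤ τ) (lam t : ℝ) :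
    Summable fun k => fundamentalTerm lam τ k t :=
  Summable.of_norm_bounded (Real.summable_pow_div_factorial (|lam| * |t|))
    fun k => abs_fundamentalTerm_le hτ lam k le_rfl

/-- Delaying by `τ` and integrating raises the index by one; this is why the series solves the
equation term by term. -/
theorem integral_fundamentalTerm {τ : ℝ} (hτ : 0 ≤ τ) (lam : ℝ) (k : ℕ) {t : ℝ} (ht : 0 ≤ t) :
    ∫ s in (0 : ℝ)..t, -lam * fundamentalTerm lam τ k (s - τ)
      = fundamentalTerm lam τ (k + 1) t := by
  have hpos : 0 ≤ ((k + 1 : ℕ) : ℝ) * τ := by positivity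
  have hzero : fundamentalTerm lam τ (k + 1) 0 = 0 := by
    unfold fundamentalTerm
    split_ifs with h
    · have : ((k + 1 : ℕ) : ℝ) * τ = 0 := le_antisymm h hpos
      rw [this]
      simp
    · rfl
  -- The positive exponent `k + 1` makes the two branches agree at the kink. The term of index `0`
  -- does jump, but it is never a primitive here.
  have hcont : Continuous (fundamentalTerm lam τ (k + 1)) := by
    unfold fundamentalTerm
    refine Continuous.if_le (by fun_prop) continuous_const continuous_const continuous_id ?_
    intro s hs
    simp [← hs]
  have hint : IntervalIntegrable (fun s => -lam * fundamentalTerm lam τ k (s - τ))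
      volume 0 t := by
    refine IntervalIntegrable.const_mul ?_ _
    refine (intervalIntegrable_const (c := (|lam| * |t|) ^ k / (k.factorial : ℝ))).mono_fun
      ((measurable_fundamentalTerm lam τ k).comp (by fun_prop)).aestronglyMeasurable ?_
    rw [Set.uIoc_of_le ht]
    refine (ae_restrict_iff' measurableSet_Ioc).2 (ae_of_all _ fun s hs => ?_)
    refine (abs_fundamentalTerm_le hτ lam k (R := t) (by linarith [hs.2])).trans ?_
    exact le_abs_self _
  have := integral_eq_of_hasDerivAt_off_countable (fundamentalTerm lam τ (k + 1))
    (fun s => -lam * fundamentalTerm lam τ k (s - τ)) (a := 0) (b := t)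
    (s := {((k + 1 : ℕ) : ℝ) * τ}) (Set.countable_singleton _) hcont.continuousOn ?_ hint
  · rw [this, hzero, sub_zero]
  rintro s ⟨-, hs⟩
  rcases lt_or_gt_of_ne (show s ≠ ((k + 1 : ℕ) : ℝ) * τ from hs) with h | h
  · have h1 : fundamentalTerm lam τ k (s - τ) = 0 := by
      unfold fundamentalTerm
      rw [if_neg]
      push_cast at h
      linarith
    rw [h1, mul_zero]
    refine (hasDerivAt_const s (0 : ℝ)).congr_of_eventuallyEq ?_
    filter_upwards [Iio_mem_nhds h] with r hr
    exact if_neg (not_le.2 hr)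
  · have h1 : fundamentalTerm lam τ k (s - τ)
        = (-lam) ^ k / (k.factorial : ℝ) * (s - τ - k * τ) ^ k := by
      unfold fundamentalTerm
      rw [if_pos]
      push_cast at h
      linarith
    rw [h1]
    have h2 : HasDerivAt (fun r : ℝ => (-lam) ^ (k + 1) / ((k + 1).factorial : ℝ)
        * (r - (k + 1 : ℕ) * τ) ^ (k + 1)) ((-lam) ^ (k + 1) / ((k + 1).factorial : ℝ)
        * (((k + 1 : ℕ) : ℝ) * (s - (k + 1 : ℕ) * τ) ^ k * 1)) s := by
      simpa using (((hasDerivAt_id s).sub_const (((k + 1 : ℕ) : ℝ) * τ)).pow (k + 1)).const_mul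
        ((-lam) ^ (k + 1) / ((k + 1).factorial : ℝ))
    have h3 : (-lam) ^ (k + 1) / ((k + 1).factorial : ℝ)
        * (((k + 1 : ℕ) : ℝ) * (s - (k + 1 : ℕ) * τ) ^ k * 1)
        = -lam * ((-lam) ^ k / (k.factorial : ℝ) * (s - τ - k * τ) ^ k) := by
      rw [Nat.factorial_succ]
      push_cast
      rw [show s - ((k : ℝ) + 1) * τ = s - τ - k * τ by ring]
      have : (k : ℝ) + 1 ≠ 0 := by positivity
      field_simp
      ring
    rw [← h3]
    refine h2.congr_of_eventuallyEq ?_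
    filter_upwards [Ioi_mem_nhds h] with r hr
    exact if_pos (le_of_lt hr)

/-- The exponential majorant also covers `τ = 0`, where the series is not locally finite. Dominated
convergence permits integration term by term, and the term of index `0` supplies the constant `1`.
-/
theorem exists_isFundamental (lam : ℝ) {τ : ℝ} (hτ : 0 ≤ τ) : ∃ φ, IsFundamental lam τ φ := by
  set φ : ℝ → ℝ := fun t => ∑' k, fundamentalTerm lam τ k t with hφ
  have hsum : ∀ t, HasSum (fun k => fundamentalTerm lam τ k t) (φ t) := fun t =>
    (summable_fundamentalTerm hτ lam t).hasSum
  have hmeas : Measurable φ :=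
    measurable_of_tendsto_metrizable
      (fun n => Finset.measurable_fun_sum (Finset.range n) fun k _ =>
        measurable_fundamentalTerm lam τ k)
      (tendsto_pi_nhds.2 fun t => (hsum t).tendsto_sum_nat)
  have hneg : ∀ t, t < 0 → φ t = 0 := fun t ht => by
    have : ∀ k, fundamentalTerm lam τ k t = 0 := fun k =>
      if_neg (not_le.2 (ht.trans_le (by positivity)))
    simp [hφ, this]
  have heq : ∀ t, 0 ≤ t → φ t = 1 - lam * ∫ s in (0 : ℝ)..t, φ (s - τ) := by
    intro t ht
    have h1 := intervalIntegral.hasSum_integral_of_dominated_convergence (μ := volume)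
      (a := 0) (b := t) (F := fun k s => -lam * fundamentalTerm lam τ k (s - τ))
      (f := fun s => -lam * φ (s - τ))
      (fun k _ => |lam| * ((|lam| * |t|) ^ k / (k.factorial : ℝ)))
      (fun k => (((measurable_fundamentalTerm lam τ k).comp
        (by fun_prop)).const_mul _).aestronglyMeasurable)
      (fun k => ae_of_all _ fun s hs => by
        rw [Set.uIoc_of_le ht] at hs
        rw [norm_mul, norm_neg]
        exact mul_le_mul_of_nonneg_left
          (abs_fundamentalTerm_le hτ lam k (by linarith [hs.2])) (norm_nonneg _))
      (ae_of_all _ fun s _ => (Real.summable_pow_div_factorial _).mul_left _)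
      (by simp)
      (ae_of_all _ fun s _ => (hsum (s - τ)).mul_left _)
    simp only [integral_fundamentalTerm hτ lam _ ht] at h1
    have h2 := (hasSum_nat_add_iff' 1).2 (hsum t)
    have h3 := h1.unique h2
    rw [intervalIntegral.integral_const_mul] at h3
    have h4 : fundamentalTerm lam τ 0 t = 1 := by simp [fundamentalTerm, ht]
    simp only [Finset.range_one, Finset.sum_singleton, h4] at h3
    linarith
  have hint : ∀ a b, IntervalIntegrable (fun s => φ (s - τ)) volume a b := by
    intro a b
    refine (intervalIntegrable_const (c := ∑' k, (|lam| * |max a b|) ^ k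
      / (k.factorial : ℝ))).mono_fun (hmeas.comp (by fun_prop)).aestronglyMeasurable ?_
    refine (ae_restrict_iff' measurableSet_uIoc).2 (ae_of_all _ fun s hs => ?_)
    refine le_trans ?_ (le_abs_self _)
    refine tsum_of_norm_bounded (Real.summable_pow_div_factorial _).hasSum fun k => ?_
    refine abs_fundamentalTerm_le hτ lam k ?_
    have := hs.2
    linarith
  -- Continuity on the half-line is read off from the integral equation.
  refine ⟨φ, ⟨⟨hneg, ?_⟩, heq⟩⟩
  have hc : Continuous fun t => 1 - lam * ∫ s in (0 : ℝ)..t, φ (s - τ) :=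
    continuous_const.sub (continuous_const.mul
      (intervalIntegral.continuous_primitive hint 0))
  exact hc.continuousOn.congr fun t ht => heq t ht

/-! ### Variation of constants -/

/-- In the convolution of causal functions a delay may be moved from one factor to the other. -/
theorem integral_mul_shift_eq {φ z : ℝ → ℝ} (hφ : IsCausal φ) (hz : IsCausal z) {τ t : ℝ}
    (hτ : 0 ≤ τ) (ht : 0 ≤ t) :
    ∫ s in (0 : ℝ)..t, φ (t - s) * z (s - τ) = ∫ s in (0 : ℝ)..t, φ (t - s - τ) * z s := by
  have h0 : ∀ a b : ℝ, a ≤ b → b ≤ 0 →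
      ∫ s in a..b, φ (t - s - τ) * z s = 0 := by
    intro a b hab hb
    refine intervalIntegral.integral_zero_ae ?_
    have : ∀ᵐ s : ℝ, s ≠ 0 := by simp [ae_iff]
    filter_upwards [this] with s hs hs'
    rw [Set.uIoc_of_le hab] at hs'
    rw [hz.neg s (lt_of_le_of_ne (hs'.2.trans hb) hs), mul_zero]
  have h1 : ∀ a b : ℝ, a ≤ b → t - τ ≤ a →
      ∫ s in a..b, φ (t - s - τ) * z s = 0 := by
    intro a b hab ha
    refine intervalIntegral.integral_zero_ae (ae_of_all _ fun s hs' => ?_)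
    rw [Set.uIoc_of_le hab] at hs'
    rw [hφ.neg _ (by linarith [hs'.1]), zero_mul]
  -- After the substitution the two integrals differ only in their range. The integrand vanishes
  -- a.e. on `s ≤ 0` because `z` is causal, and on `s > t - τ` because `φ` is.
  have h2 : ∫ s in (0 : ℝ)..t, φ (t - s) * z (s - τ)
      = ∫ s in (0 - τ)..(t - τ), φ (t - s - τ) * z s := by
    rw [← intervalIntegral.integral_comp_sub_right (fun s => φ (t - s - τ) * z s) τ]
    congr 1
    funext s
    rw [show t - (s - τ) - τ = t - s by ring]
  rw [h2]
  rcases le_total τ t with h | h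
  · have hi : ∀ b, 0 ≤ b → b ≤ t - τ →
        IntervalIntegrable (fun s => φ (t - s - τ) * z s) volume 0 b := by
      intro b hb hb'
      refine ContinuousOn.intervalIntegrable ?_
      refine ContinuousOn.mul ?_ (hz.continuousOn_uIcc hb)
      refine hφ.cont.comp (by fun_prop) fun s hs => ?_
      rw [Set.uIcc_of_le hb] at hs
      exact Set.mem_Ici.2 (by linarith [hs.2])
    have hzero : ∀ a b : ℝ, a ≤ b → b ≤ 0 →
        IntervalIntegrable (fun s => φ (t - s - τ) * z s) volume a b := by
      intro a b hab hb
      refine (intervalIntegrable_const (c := (0 : ℝ))).congr_ae ?_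
      rw [Set.uIoc_of_le hab]
      refine (ae_restrict_iff' measurableSet_Ioc).2 ?_
      have : ∀ᵐ s : ℝ, s ≠ 0 := by simp [ae_iff]
      filter_upwards [this] with s hs hs'
      rw [hz.neg s (lt_of_le_of_ne (hs'.2.trans hb) hs), mul_zero]
    have hzero' : IntervalIntegrable (fun s => φ (t - s - τ) * z s) volume (t - τ) t := by
      refine (intervalIntegrable_const (c := (0 : ℝ))).congr_ae ?_
      rw [Set.uIoc_of_le (by linarith)]
      refine (ae_restrict_iff' measurableSet_Ioc).2 (ae_of_all _ fun s hs' => ?_)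
      change (0 : ℝ) = φ (t - s - τ) * z s
      rw [hφ.neg _ (by linarith [hs'.1]), zero_mul]
    have h3 := hi (t - τ) (by linarith) le_rfl
    rw [← intervalIntegral.integral_add_adjacent_intervals
        (hzero (0 - τ) 0 (by linarith) le_rfl) h3,
      h0 (0 - τ) 0 (by linarith) le_rfl,
      ← intervalIntegral.integral_add_adjacent_intervals h3 hzero',
      h1 (t - τ) t (by linarith) le_rfl]
    ring
  · rw [h0 _ _ (by linarith) (by linarith), h1 _ _ ht (by linarith)]

/-- Variation of constants for the integrated delay equation with a continuous forcing. -/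
theorem IsFundamental.variation_of_constants {lam τ : ℝ} {φ : ℝ → ℝ}
    (hφ : IsFundamental lam τ φ) (hτ : 0 ≤ τ) {z N : ℝ → ℝ} {z₀ : ℝ} (hz : IsCausal z)
    (hN : ContinuousOn N (Set.Ici 0))
    (heq : ∀ t, 0 ≤ t → z t = z₀ - lam * (∫ s in (0 : ℝ)..t, z (s - τ)) + N t)
    {t : ℝ} (ht : 0 ≤ t) :
    z t = φ t * z₀ + N t - lam * ∫ s in (0 : ℝ)..t, φ (t - s - τ) * N s := by
  -- `Z = z - N` is differentiable off one point even though `N` is not; differentiating `φ(t-s)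
  -- Z(s)` therefore never differentiates the noise.
  set Z : ℝ → ℝ := fun t => z₀ - lam * ∫ s in (0 : ℝ)..t, z (s - τ) with hZ
  have hZc : Continuous Z :=
    continuous_const.sub (continuous_const.mul (hz.continuous_primitive_comp_sub τ))
  have hzZ : ∀ s, 0 ≤ s → Z s = z s - N s := fun s hs => by rw [heq s hs, hZ]; ring
  have hφc : ContinuousOn (fun s => φ (t - s)) (Set.uIcc 0 t) := by
    refine hφ.cont.comp (by fun_prop) fun s hs => ?_
    rw [Set.uIcc_of_le ht] at hs
    exact Set.mem_Ici.2 (by linarith [hs.2])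
  have hNc : ContinuousOn N (Set.uIcc 0 t) := hN.mono fun s hs => by
    rw [Set.uIcc_of_le ht] at hs
    exact hs.1
  have hφi : IntervalIntegrable (fun s => φ (t - s - τ)) volume 0 t := by
    simpa [sub_right_comm] using hφ.intervalIntegrable_comp_const_sub (t - τ) 0 t
  have i1 : IntervalIntegrable (fun s => φ (t - s - τ) * z s) volume 0 t :=
    hφi.mul_continuousOn (hz.continuousOn_uIcc ht)
  have i2 : IntervalIntegrable (fun s => φ (t - s - τ) * N s) volume 0 t :=
    hφi.mul_continuousOn hNc
  have i3 : IntervalIntegrable (fun s => φ (t - s) * z (s - τ)) volume 0 t :=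
    (hz.intervalIntegrable_comp_sub τ 0 t).continuousOn_mul hφc
  have hI : IntervalIntegrable (fun s => lam * (φ (t - s - τ) * z s - φ (t - s - τ) * N s
      - φ (t - s) * z (s - τ))) volume 0 t := ((i1.sub i2).sub i3).const_mul lam
  -- The excluded points come from jumps of causal functions at `0`: `Z` has its kink at `τ`, and
  -- `φ(t - ·)` at `t - τ`. The two convolutions containing `z` then cancel by
  -- `integral_mul_shift_eq`.
  have hftc := integral_eq_of_hasDerivAt_off_countable (fun s => φ (t - s) * Z s)
    (fun s => lam * (φ (t - s - τ) * z s - φ (t - s - τ) * N s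
      - φ (t - s) * z (s - τ))) (a := 0) (b := t) (s := {τ, t - τ})
    (by simp) (hφc.mul hZc.continuousOn) ?_ hI
  · rw [intervalIntegral.integral_const_mul, intervalIntegral.integral_sub (i1.sub i2) i3,
      intervalIntegral.integral_sub i1 i2, integral_mul_shift_eq hφ.toIsCausal hz hτ ht,
      sub_self, hφ.zero, hzZ t ht] at hftc
    have hZ0 : Z 0 = z₀ := by simp [hZ]
    rw [sub_zero, hZ0] at hftc
    linarith
  · rintro s ⟨hs, hs'⟩
    rw [min_eq_left ht, max_eq_right ht] at hs
    simp only [Set.mem_insert_iff, Set.mem_singleton_iff, not_or] at hs'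
    have d1 : HasDerivAt (fun s => φ (t - s)) (lam * φ (t - s - τ)) s := by
      have := (hφ.hasDerivAt (t := t - s) (by linarith [hs.2])
        (fun h => hs'.2 (by linarith))).comp_const_sub t s
      simpa using this
    have d2 : HasDerivAt Z (-(lam * z (s - τ))) s :=
      ((hz.hasDerivAt_primitive_comp_sub τ hs'.1).const_mul lam).const_sub z₀
    refine (d1.mul d2).congr_deriv ?_
    rw [hzZ s hs.1.le]
    ring

/-! ### Positivity of the boundary form -/

theorem one_le_cos_add_sin {T : ℝ} (h0 : 0 ≤ T) (h1 : T ≤ Real.pi / 2) :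
    1 ≤ Real.cos T + Real.sin T := by
  have hc := Real.cos_nonneg_of_neg_pi_div_two_le_of_le (by linarith) h1
  have hs := Real.sin_nonneg_of_nonneg_of_le_pi h0 (by linarith [Real.pi_pos])
  nlinarith [Real.sin_sq_add_cos_sq T, mul_nonneg hc hs]

/-- The form `2 f(p) f(t) + ∫ (f'² - f²)` is nonnegative on intervals shorter than `π / 2`. -/
theorem boundaryForm_nonneg {p t : ℝ} (hpt : p ≤ t) (hT : t - p < Real.pi / 2) {F G : ℝ → ℝ}
    {S : Set ℝ} (hS : S.Countable) (hF : Continuous F) (hG : Continuous G)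
    (hd : ∀ a, a ∉ S → HasDerivAt F (G a) a) :
    0 ≤ 2 * F t * F p + ∫ a in p..t, (G a ^ 2 - F a ^ 2) := by
  rcases hpt.eq_or_lt with rfl | hlt
  · simp only [intervalIntegral.integral_same, add_zero]
    nlinarith [sq_nonneg (F p)]
  set T := t - p with hTdef
  have hT0 : 0 < T := sub_pos.2 hlt
  have hsin : 0 < Real.sin T := Real.sin_pos_of_pos_of_lt_pi hT0 (by linarith [Real.pi_pos])
  set α := F p
  set β := F t
  set ε := (Real.pi / 2 - T) / 2 with hε
  have hε0 : 0 < ε := by rw [hε]; linarith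
  -- The extremal `f'' = -f` with the endpoint values of `F`. The remainder `F - f` vanishes at both
  -- ends and is handled by Jacobi's completion of the square.
  set f : ℝ → ℝ := fun a => (α * Real.sin (t - a) + β * Real.sin (a - p)) / Real.sin T with hf
  set f' : ℝ → ℝ := fun a => (-(α * Real.cos (t - a)) + β * Real.cos (a - p)) / Real.sin T
    with hf'
  -- The cotangent solves the Riccati equation `c' = -(1 + c²)`. The shift `ε` moves its pole off `a
  -- = p` while keeping `T + ε < π/2`.
  set ct : ℝ → ℝ := fun a => Real.cos (a - p + ε) / Real.sin (a - p + ε) with hct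
  have hsne : ∀ a ∈ Set.Icc p t, Real.sin (a - p + ε) ≠ 0 := fun a ha => by
    refine (Real.sin_pos_of_pos_of_lt_pi (by linarith [ha.1]) ?_).ne'
    have : a - p ≤ T := by rw [hTdef]; linarith [ha.2]
    linarith [Real.pi_pos]
  have hfd : ∀ a, HasDerivAt f (f' a) a := fun a => by
    have h1 : HasDerivAt (fun a => Real.sin (t - a)) (-Real.cos (t - a)) a := by
      simpa using (Real.hasDerivAt_sin (t - a)).comp_const_sub t a
    have h2 : HasDerivAt (fun a => Real.sin (a - p)) (Real.cos (a - p)) a := by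
      simpa using (Real.hasDerivAt_sin (a - p)).comp_sub_const a p
    refine (((h1.const_mul α).add (h2.const_mul β)).div_const _).congr_deriv ?_
    simp only [hf']
    ring
  have hfd' : ∀ a, HasDerivAt f' (-f a) a := fun a => by
    have h1 : HasDerivAt (fun a => Real.cos (t - a)) (Real.sin (t - a)) a := by
      simpa using (Real.hasDerivAt_cos (t - a)).comp_const_sub t a
    have h2 : HasDerivAt (fun a => Real.cos (a - p)) (-Real.sin (a - p)) a := by
      simpa using (Real.hasDerivAt_cos (a - p)).comp_sub_const a p
    refine (((h1.const_mul α).neg.add (h2.const_mul β)).div_const _).congr_deriv ?_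
    simp only [hf]
    ring
  have hcd : ∀ a ∈ Set.Icc p t, HasDerivAt ct (-(1 + ct a ^ 2)) a := fun a ha => by
    have h1 : HasDerivAt (fun a => a - p + ε) 1 a := by
      simpa using ((hasDerivAt_id a).sub_const p).add_const ε
    have h2 := h1.cos.div h1.sin (hsne a ha)
    refine h2.congr_deriv ?_
    have := hsne a ha
    simp only [hct]
    field_simp
    ring
  -- `R' = r`, and `r` is the integrand minus a perfect square. At the endpoints `F = f`, so `R`
  -- reduces to `f f'` there.
  set R : ℝ → ℝ := fun a => ct a * (F a - f a) ^ 2 + 2 * f' a * (F a - f a) + f a * f' a with hR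
  set r : ℝ → ℝ := fun a => (G a ^ 2 - F a ^ 2) - ((G a - f' a) - ct a * (F a - f a)) ^ 2 with hr
  have hfc : Continuous f := continuous_iff_continuousAt.2 fun a => (hfd a).continuousAt
  have hfc' : Continuous f' := continuous_iff_continuousAt.2 fun a => (hfd' a).continuousAt
  have hcc : ContinuousOn ct (Set.uIcc p t) := fun a ha => by
    rw [Set.uIcc_of_le hpt] at ha
    exact (hcd a ha).continuousAt.continuousWithinAt
  have hRc : ContinuousOn R (Set.uIcc p t) :=
    ((hcc.mul (by fun_prop)).add (by fun_prop)).add (by fun_prop)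
  have hrc : ContinuousOn r (Set.uIcc p t) :=
    ContinuousOn.sub (by fun_prop) (((by fun_prop : Continuous fun a => G a - f' a).continuousOn.sub
      (hcc.mul (by fun_prop))).pow 2)
  have hftc := integral_eq_of_hasDerivAt_off_countable R r hS hRc (fun a ha => ?_)
    hrc.intervalIntegrable
  · have hle : ∫ a in p..t, r a ≤ ∫ a in p..t, (G a ^ 2 - F a ^ 2) := by
      refine intervalIntegral.integral_mono_on hpt hrc.intervalIntegrable
        (Continuous.intervalIntegrable (by fun_prop) _ _) fun a _ => ?_
      simp only [hr]
      linarith [sq_nonneg ((G a - f' a) - ct a * (F a - f a))]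
    have e1 : f p = α := by
      simp only [hf, sub_self, Real.sin_zero, mul_zero, add_zero]
      exact mul_div_cancel_right₀ _ hsin.ne'
    have e2 : f t = β := by
      simp only [hf, sub_self, Real.sin_zero, mul_zero, zero_add]
      exact mul_div_cancel_right₀ _ hsin.ne'
    have e3 : R t - R p = ((α ^ 2 + β ^ 2) * Real.cos T - 2 * α * β) / Real.sin T := by
      simp only [hR, e1, e2, hf', sub_self, Real.cos_zero, mul_one]
      change ct t * (β - β) ^ 2 + _ * (β - β) + _ - (ct p * (α - α) ^ 2 + _ * (α - α) + _) = _
      rw [← hTdef]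
      ring
    have h4 := one_le_cos_add_sin hT0.le hT.le
    have h5 : 0 ≤ 2 * β * α + ((α ^ 2 + β ^ 2) * Real.cos T - 2 * α * β) / Real.sin T := by
      rw [show 2 * β * α + ((α ^ 2 + β ^ 2) * Real.cos T - 2 * α * β) / Real.sin T
        = ((α ^ 2 + β ^ 2) * (Real.cos T + Real.sin T - 1)
          + (1 - Real.sin T) * (α - β) ^ 2) / Real.sin T by field_simp; ring]
      refine div_nonneg (add_nonneg (mul_nonneg (by positivity) (by linarith))
        (mul_nonneg (by linarith [Real.sin_le_one T]) (sq_nonneg _))) hsin.le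
    rw [← e3, ← hftc] at h5
    linarith
  · obtain ⟨ha, haS⟩ := ha
    rw [min_eq_left hpt, max_eq_right hpt] at ha
    have d0 := (hd a haS).sub (hfd a)
    refine ((((hcd a (Set.Ioo_subset_Icc_self ha)).mul (d0.pow 2)).add
      (((hfd' a).const_mul 2).mul d0)).add ((hfd a).mul (hfd' a))).congr_deriv ?_
    simp only [hr, Pi.sub_apply, Pi.pow_apply]
    push_cast
    ring

/-! ### A complete Lyapunov functional for the delay equation with unit gain -/

/-- The cosine moment `∫₀ᵗ x(s) cos s ds`. -/
noncomputable def cosMoment (x : ℝ → ℝ) (t : ℝ) : ℝ := ∫ s in (0 : ℝ)..t, x s * Real.cos s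

/-- The sine moment `∫₀ᵗ x(s) sin s ds`. -/
noncomputable def sinMoment (x : ℝ → ℝ) (t : ℝ) : ℝ := ∫ s in (0 : ℝ)..t, x s * Real.sin s

/-- The iterated moment `∫₀ᵗ ∫₀ᵃ x(a) x(b) sin (a - b) db da`. -/
noncomputable def iteratedMoment (x : ℝ → ℝ) (t : ℝ) : ℝ :=
  ∫ a in (0 : ℝ)..t, x a * (Real.sin a * cosMoment x a - Real.cos a * sinMoment x a)

section Moments

variable {x : ℝ → ℝ} (hx : IsCausal x)
include hx

theorem continuous_cosMoment : Continuous (cosMoment x) :=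
  (hx.mul_continuous Real.continuous_cos).continuous_primitive

theorem continuous_sinMoment : Continuous (sinMoment x) :=
  (hx.mul_continuous Real.continuous_sin).continuous_primitive

theorem isCausal_iteratedMoment_integrand :
    IsCausal fun a => x a * (Real.sin a * cosMoment x a - Real.cos a * sinMoment x a) :=
  hx.mul_continuous ((Real.continuous_sin.mul (continuous_cosMoment hx)).sub
    (Real.continuous_cos.mul (continuous_sinMoment hx)))

theorem continuous_iteratedMoment : Continuous (iteratedMoment x) :=
  (isCausal_iteratedMoment_integrand hx).continuous_primitive

theorem hasDerivAt_cosMoment {t : ℝ} (ht : t ≠ 0) :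
    HasDerivAt (cosMoment x) (x t * Real.cos t) t :=
  (hx.mul_continuous Real.continuous_cos).hasDerivAt_primitive ht

theorem hasDerivAt_sinMoment {t : ℝ} (ht : t ≠ 0) :
    HasDerivAt (sinMoment x) (x t * Real.sin t) t :=
  (hx.mul_continuous Real.continuous_sin).hasDerivAt_primitive ht

theorem hasDerivAt_iteratedMoment {t : ℝ} (ht : t ≠ 0) :
    HasDerivAt (iteratedMoment x)
      (x t * (Real.sin t * cosMoment x t - Real.cos t * sinMoment x t)) t :=
  (isCausal_iteratedMoment_integrand hx).hasDerivAt_primitive ht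

theorem cosMoment_of_nonpos {t : ℝ} (ht : t ≤ 0) : cosMoment x t = 0 :=
  (hx.mul_continuous Real.continuous_cos).primitive_of_nonpos ht

theorem sinMoment_of_nonpos {t : ℝ} (ht : t ≤ 0) : sinMoment x t = 0 :=
  (hx.mul_continuous Real.continuous_sin).primitive_of_nonpos ht

theorem iteratedMoment_of_nonpos {t : ℝ} (ht : t ≤ 0) : iteratedMoment x t = 0 :=
  (isCausal_iteratedMoment_integrand hx).primitive_of_nonpos ht

end Moments

/-- The complete Lyapunov functional along `x`: the value at time `t` of the quadratic form with
kernel `A cos (a - b) - sin |a - b| / 2` in the measure `x(t) δ_{t-T} - x(s) ds` on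
`[t - T, t]`. -/
noncomputable def lyapunov (A T : ℝ) (x : ℝ → ℝ) (t : ℝ) : ℝ :=
  A * x t ^ 2
    - 2 * x t * (A * (Real.cos (t - T) * (cosMoment x t - cosMoment x (t - T))
          + Real.sin (t - T) * (sinMoment x t - sinMoment x (t - T)))
        - 1 / 2 * (Real.cos (t - T) * (sinMoment x t - sinMoment x (t - T))
          - Real.sin (t - T) * (cosMoment x t - cosMoment x (t - T))))
    + A * ((cosMoment x t - cosMoment x (t - T)) ^ 2
        + (sinMoment x t - sinMoment x (t - T)) ^ 2)
    - (iteratedMoment x t - iteratedMoment x (t - T)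
        - (sinMoment x t - sinMoment x (t - T)) * cosMoment x (t - T)
        + (cosMoment x t - cosMoment x (t - T)) * sinMoment x (t - T))

/-- Along the fundamental solution the Lyapunov functional decreases at the rate `x²`. -/
theorem hasDerivAt_lyapunov {A T : ℝ} (h1 : 2 * A * Real.cos T = 1 + Real.sin T)
    (h2 : 2 * A * (1 - Real.sin T) = Real.cos T) {x : ℝ → ℝ} (hx : IsFundamental 1 T x)
    {t : ℝ} (ht : 0 < t) (htT : t ≠ T) :
    HasDerivAt (lyapunov A T x) (-x t ^ 2) t := by
  have hc := hx.toIsCausal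
  have hp : t - T ≠ 0 := sub_ne_zero.2 htT
  have dx : HasDerivAt x (-x (t - T)) t := by simpa using hx.hasDerivAt ht htT
  have dcp : HasDerivAt (fun t => Real.cos (t - T)) (-Real.sin (t - T)) t := by
    simpa using (Real.hasDerivAt_cos (t - T)).comp_sub_const t T
  have dsp : HasDerivAt (fun t => Real.sin (t - T)) (Real.cos (t - T)) t := by
    simpa using (Real.hasDerivAt_sin (t - T)).comp_sub_const t T
  have dCp := (hasDerivAt_cosMoment hc hp).comp_sub_const t T
  have dSp := (hasDerivAt_sinMoment hc hp).comp_sub_const t T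
  have dDp := (hasDerivAt_iteratedMoment hc hp).comp_sub_const t T
  have dC := (hasDerivAt_cosMoment hc ht.ne').sub dCp
  have dS := (hasDerivAt_sinMoment hc ht.ne').sub dSp
  have dD := (hasDerivAt_iteratedMoment hc ht.ne').sub dDp
  have key := ((((dx.pow 2).const_mul A).sub ((dx.const_mul 2).mul
    ((((dcp.mul dC).add (dsp.mul dS)).const_mul A).sub
      (((dcp.mul dS).sub (dsp.mul dC)).const_mul (1 / 2))))).add
    (((dC.pow 2).add (dS.pow 2)).const_mul A)).sub ((dD.sub (dS.mul dCp)).add (dC.mul dSp))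
  refine key.congr_deriv ?_
  simp only [Pi.sub_apply, Pi.add_apply, Pi.mul_apply]
  have e1 : Real.cos t = Real.cos (t - T) * Real.cos T - Real.sin (t - T) * Real.sin T := by
    rw [← Real.cos_add]
    ring_nf
  have e2 : Real.sin t = Real.sin (t - T) * Real.cos T + Real.cos (t - T) * Real.sin T := by
    rw [← Real.sin_add]
    ring_nf
  have e3 := Real.sin_sq_add_cos_sq (t - T)
  rw [e1, e2]
  generalize Real.cos (t - T) = cp at *
  generalize Real.sin (t - T) = sp at *
  generalize Real.cos T = cT at *
  generalize Real.sin T = sT at *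
  generalize x (t - T) = q at *
  generalize x t = X at *
  generalize cosMoment x (t - T) = Cp at *
  generalize sinMoment x (t - T) = Sp at *
  generalize cosMoment x t = C at *
  generalize sinMoment x t = S at *
  push_cast
  -- With `U(s) = A cos s - sin s / 2`, the relations `h1` and `h2` say `U(T) = 1/2` and `U'(T) =
  -- -U(0)`; they are what makes the delayed terms cancel.
  linear_combination (X * (C - Cp) * cp + X * (S - Sp) * sp - X ^ 2) * h1
    + (X * (C - Cp) * sp - X * (S - Sp) * cp) * h2
    - 2 * X * (A * (cT * X - q) - 1 / 2 * sT * X) * e3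

/-- Let `F` be the potential of the measure `μ = x(t) δ_p - x(s) ds` on `[p, t]`, with `p = t - T`.
The kernel satisfies `U'' + U = -δ`, so `F'' + F = x` inside the window. Integrating `∫ F dμ` by
parts, with boundary values fixed by `h1` and `h2`, gives exactly the form in `boundaryForm_nonneg`.
-/
theorem lyapunov_nonneg {A T : ℝ} (hT : 0 ≤ T) (hT' : T < Real.pi / 2)
    (h1 : 2 * A * Real.cos T = 1 + Real.sin T)
    (h2 : 2 * A * (1 - Real.sin T) = Real.cos T) {x : ℝ → ℝ} (hx : IsCausal x) (t : ℝ) :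
    0 ≤ lyapunov A T x t := by
  set p := t - T with hp
  have htp : t - p = T := by rw [hp]; ring
  set C := cosMoment x t with hC
  set Cp := cosMoment x p with hCp
  set S := sinMoment x t with hS
  set Sp := sinMoment x p with hSp
  set X := x t
  -- `F` is the potential expanded in moments, `G` its derivative, and `K` a primitive of `F x`.
  set F : ℝ → ℝ := fun a => X * (A * Real.cos (a - p) - 1 / 2 * Real.sin (a - p))
    - A * (Real.cos a * (C - Cp) + Real.sin a * (S - Sp))
    + 1 / 2 * (Real.sin a * (2 * cosMoment x a - (C + Cp))
      - Real.cos a * (2 * sinMoment x a - (S + Sp))) with hF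
  set G : ℝ → ℝ := fun a => X * (A * -Real.sin (a - p) - 1 / 2 * Real.cos (a - p))
    - A * (-Real.sin a * (C - Cp) + Real.cos a * (S - Sp))
    + 1 / 2 * (Real.cos a * (2 * cosMoment x a - (C + Cp))
      + Real.sin a * (2 * sinMoment x a - (S + Sp))) with hG
  set K : ℝ → ℝ := fun a => X * (A * (Real.cos p * cosMoment x a + Real.sin p * sinMoment x a)
      - 1 / 2 * (Real.cos p * sinMoment x a - Real.sin p * cosMoment x a))
    - A * ((C - Cp) * cosMoment x a + (S - Sp) * sinMoment x a)
    + iteratedMoment x a - 1 / 2 * ((C + Cp) * sinMoment x a)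
    + 1 / 2 * ((S + Sp) * cosMoment x a) with hK
  have cC := continuous_cosMoment hx
  have cS := continuous_sinMoment hx
  have cD := continuous_iteratedMoment hx
  have hFc : Continuous F := by fun_prop
  have hGc : Continuous G := by fun_prop
  have hKc : Continuous K := by fun_prop
  have dcp : ∀ a, HasDerivAt (fun a => Real.cos (a - p)) (-Real.sin (a - p)) a := fun a => by
    simpa using (Real.hasDerivAt_cos (a - p)).comp_sub_const a p
  have dsp : ∀ a, HasDerivAt (fun a => Real.sin (a - p)) (Real.cos (a - p)) a := fun a => by
    simpa using (Real.hasDerivAt_sin (a - p)).comp_sub_const a p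
  have hFd : ∀ a, a ∉ ({0} : Set ℝ) → HasDerivAt F (G a) a := fun a ha => by
    have ha : a ≠ 0 := ha
    refine ((((((dcp a).const_mul A).sub ((dsp a).const_mul (1 / 2))).const_mul X).sub
      ((((Real.hasDerivAt_cos a).mul_const (C - Cp)).add
        ((Real.hasDerivAt_sin a).mul_const (S - Sp))).const_mul A)).add
      ((((Real.hasDerivAt_sin a).mul
          (((hasDerivAt_cosMoment hx ha).const_mul 2).sub_const (C + Cp))).sub
        ((Real.hasDerivAt_cos a).mul
          (((hasDerivAt_sinMoment hx ha).const_mul 2).sub_const (S + Sp)))).const_mul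
            (1 / 2))).congr_deriv ?_
    simp only [hG]
    ring
  have hGd : ∀ a, a ∉ ({0} : Set ℝ) → HasDerivAt G (-F a + x a) a := fun a ha => by
    have ha : a ≠ 0 := ha
    refine ((((((dsp a).neg.const_mul A).sub ((dcp a).const_mul (1 / 2))).const_mul X).sub
      ((((Real.hasDerivAt_sin a).neg.mul_const (C - Cp)).add
        ((Real.hasDerivAt_cos a).mul_const (S - Sp))).const_mul A)).add
      ((((Real.hasDerivAt_cos a).mul
          (((hasDerivAt_cosMoment hx ha).const_mul 2).sub_const (C + Cp))).add
        ((Real.hasDerivAt_sin a).mul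
          (((hasDerivAt_sinMoment hx ha).const_mul 2).sub_const (S + Sp)))).const_mul
            (1 / 2))).congr_deriv ?_
    simp only [hF]
    linear_combination x a * Real.sin_sq_add_cos_sq a
  have hKd : ∀ a, a ∉ ({0} : Set ℝ) → HasDerivAt K (F a * x a) a := fun a ha => by
    have ha : a ≠ 0 := ha
    have dC := hasDerivAt_cosMoment hx ha
    have dS := hasDerivAt_sinMoment hx ha
    refine ((((((((dC.const_mul (Real.cos p)).add (dS.const_mul (Real.sin p))).const_mul A).sub
      (((dS.const_mul (Real.cos p)).sub (dC.const_mul (Real.sin p))).const_mul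
        (1 / 2))).const_mul X).sub (((dC.const_mul (C - Cp)).add
          (dS.const_mul (S - Sp))).const_mul A)).add (hasDerivAt_iteratedMoment hx ha)).sub
      ((dS.const_mul (C + Cp)).const_mul (1 / 2))).add
      ((dC.const_mul (S + Sp)).const_mul (1 / 2)) |>.congr_deriv ?_
    simp only [hF]
    rw [Real.cos_sub a p, Real.sin_sub a p]
    ring
  have hint := integral_eq_of_hasDerivAt_off_countable (fun a => F a * G a - K a)
    (fun a => G a ^ 2 - F a ^ 2) (a := p) (b := t) (s := {0}) (Set.countable_singleton 0)
    (by fun_prop) (fun a ha => ?_) (Continuous.intervalIntegrable (by fun_prop) _ _)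
  · have e1 : Real.cos t = Real.cos p * Real.cos T - Real.sin p * Real.sin T := by
      rw [← Real.cos_add, ← htp]
      ring_nf
    have e2 : Real.sin t = Real.sin p * Real.cos T + Real.cos p * Real.sin T := by
      rw [← Real.sin_add, ← htp]
      ring_nf
    -- The boundary relations of the kernel, `U'(T) = -U(0)` and `U'(0+) = U(T) - 1`, passed on to
    -- the potential. The `-1`, due to the unit derivative jump of the kernel, becomes the `-X` in
    -- `b2`.
    have b1 : G t = -F p := by
      simp only [hF, hG, htp, sub_self, Real.cos_zero, Real.sin_zero, ← hC, ← hS, ← hCp, ← hSp]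
      rw [e1, e2]
      linear_combination (X / 2 - (C - Cp) * Real.cos p / 2 - (S - Sp) * Real.sin p / 2) * h2
        + ((C - Cp) * Real.sin p / 2 - (S - Sp) * Real.cos p / 2) * h1
    have b2 : G p = F t - X := by
      simp only [hF, hG, htp, sub_self, Real.cos_zero, Real.sin_zero, ← hC, ← hS, ← hCp, ← hSp]
      rw [e1, e2]
      linear_combination -(X / 2 - (C - Cp) * Real.cos p / 2 - (S - Sp) * Real.sin p / 2) * h1
        - (-(C - Cp) * Real.sin p / 2 + (S - Sp) * Real.cos p / 2) * h2
    have hV : lyapunov A T x t = X * F p - (K t - K p) := by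
      simp only [lyapunov, hF, hK, sub_self, Real.cos_zero, Real.sin_zero, ← hC, ← hS, ← hCp,
        ← hSp, ← hp]
      ring
    have hpos := boundaryForm_nonneg (p := p) (t := t) (by linarith) (by linarith)
      (Set.countable_singleton 0) hFc hGc hFd
    rw [hint, b1, b2] at hpos
    rw [hV]
    linarith
  · refine (((hFd a ha.2).mul (hGd a ha.2)).sub (hKd a ha.2)).congr_deriv ?_
    ring

/-! ### Decay and energy of the fundamental solution -/

/-- `V' = -x²` off one point. At time `0` the past is zero, so only `A x(0)² = A` survives in `V`.
-/
theorem integral_sq_add_lyapunov {A T : ℝ} (hT : 0 ≤ T)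
    (h1 : 2 * A * Real.cos T = 1 + Real.sin T)
    (h2 : 2 * A * (1 - Real.sin T) = Real.cos T) {x : ℝ → ℝ} (hx : IsFundamental 1 T x)
    {t : ℝ} (ht : 0 ≤ t) :
    (∫ s in (0 : ℝ)..t, x s ^ 2) + lyapunov A T x t = A := by
  have hc := hx.toIsCausal
  have hcont : ContinuousOn (lyapunov A T x) (Set.uIcc 0 t) := by
    have hxc := hc.continuousOn_uIcc ht
    have cC := continuous_cosMoment hc
    have cS := continuous_sinMoment hc
    have cD := continuous_iteratedMoment hc
    unfold lyapunov
    exact ((((hxc.pow 2).const_mul A).sub ((hxc.const_mul 2).mul (by fun_prop))).add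
      (by fun_prop)).sub (by fun_prop)
  have h := integral_eq_of_hasDerivAt_off_countable (lyapunov A T x) (fun s => -x s ^ 2)
    (a := 0) (b := t) (s := {T}) (Set.countable_singleton T) hcont (fun s hs => ?_)
    (((hc.continuousOn_uIcc ht).pow 2).neg.intervalIntegrable)
  · have h0 : lyapunov A T x 0 = A := by
      have hneg : 0 - T ≤ 0 := by linarith
      unfold lyapunov
      rw [hx.zero, cosMoment_of_nonpos hc le_rfl, sinMoment_of_nonpos hc le_rfl,
        iteratedMoment_of_nonpos hc le_rfl, cosMoment_of_nonpos hc hneg,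
        sinMoment_of_nonpos hc hneg, iteratedMoment_of_nonpos hc hneg]
      ring
    rw [intervalIntegral.integral_neg, h0] at h
    linarith
  · rw [min_eq_left ht, max_eq_right ht] at hs
    exact hasDerivAt_lyapunov h1 h2 hx hs.1.1 hs.2

theorem tendsto_window_integral {f : ℝ → ℝ} (hf : Tendsto f atTop (𝓝 0)) (T : ℝ) :
    Tendsto (fun t => ∫ a in (t - T)..t, f a) atTop (𝓝 0) := by
  rw [Metric.tendsto_atTop] at hf ⊢
  intro ε hε
  obtain ⟨R, hR⟩ := hf (ε / (|T| + 1)) (by positivity)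
  refine ⟨R + |T|, fun t ht => ?_⟩
  have h : ∀ a ∈ Set.uIoc (t - T) t, ‖f a‖ ≤ ε / (|T| + 1) := fun a ha => by
    have h1 : min (t - T) t < a := ha.1
    have h2 : R ≤ min (t - T) t :=
      le_min (by linarith [le_abs_self T]) (by linarith [abs_nonneg T])
    have := hR a (h2.trans h1.le)
    rw [dist_zero_right] at this
    exact this.le
  have h3 := intervalIntegral.norm_integral_le_of_norm_le_const h
  rw [dist_zero_right]
  refine h3.trans_lt ?_
  rw [sub_sub_cancel, div_mul_eq_mul_div, div_lt_iff₀ (by positivity)]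
  nlinarith [abs_nonneg T]

theorem tendsto_lyapunov {A T : ℝ} (hT : 0 ≤ T) {x : ℝ → ℝ} (hc : IsCausal x)
    (hx : Tendsto x atTop (𝓝 0)) : Tendsto (lyapunov A T x) atTop (𝓝 0) := by
  have mul_bdd : ∀ {f g : ℝ → ℝ} {K : ℝ}, Tendsto f atTop (𝓝 0) → (∀ t, |g t| ≤ K) →
      Tendsto (fun t => g t * f t) atTop (𝓝 0) := fun {f g K} hf hg => by
    refine squeeze_zero_norm (a := fun t => K * |f t|) (fun t => ?_) ?_
    · rw [norm_mul]
      exact mul_le_mul_of_nonneg_right (hg t) (abs_nonneg _)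
    · simpa using (hf.abs).const_mul K
  have iC := fun a b => (hc.mul_continuous Real.continuous_cos).intervalIntegrable a b
  have iS := fun a b => (hc.mul_continuous Real.continuous_sin).intervalIntegrable a b
  have iD := fun a b => (isCausal_iteratedMoment_integrand hc).intervalIntegrable a b
  have eC : ∀ p t, cosMoment x t - cosMoment x p = ∫ a in p..t, x a * Real.cos a := fun p t =>
    intervalIntegral.integral_interval_sub_left (iC _ _) (iC _ _)
  have eS : ∀ p t, sinMoment x t - sinMoment x p = ∫ a in p..t, x a * Real.sin a := fun p t =>
    intervalIntegral.integral_interval_sub_left (iS _ _) (iS _ _)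
  have hC : Tendsto (fun t => cosMoment x t - cosMoment x (t - T)) atTop (𝓝 0) := by
    simp only [eC]
    refine tendsto_window_integral ?_ T
    simpa only [mul_comm] using mul_bdd hx Real.abs_cos_le_one
  have hS : Tendsto (fun t => sinMoment x t - sinMoment x (t - T)) atTop (𝓝 0) := by
    simp only [eS]
    refine tendsto_window_integral ?_ T
    simpa only [mul_comm] using mul_bdd hx Real.abs_sin_le_one
  have hD : Tendsto (fun t => iteratedMoment x t - iteratedMoment x (t - T)
        - (sinMoment x t - sinMoment x (t - T)) * cosMoment x (t - T)
        + (cosMoment x t - cosMoment x (t - T)) * sinMoment x (t - T)) atTop (𝓝 0) := by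
    -- The moments accumulated before the window need not be small. In this combination they cancel,
    -- leaving a double integral over the window alone.
    have eD : ∀ p t, iteratedMoment x t - iteratedMoment x p
        - (sinMoment x t - sinMoment x p) * cosMoment x p
        + (cosMoment x t - cosMoment x p) * sinMoment x p
        = ∫ a in p..t, x a * (Real.sin a * (cosMoment x a - cosMoment x p)
          - Real.cos a * (sinMoment x a - sinMoment x p)) := by
      intro p t
      rw [eC, eS, ← intervalIntegral.integral_mul_const, ← intervalIntegral.integral_mul_const,
        show iteratedMoment x t - iteratedMoment x p = ∫ a in p..t, x a *
          (Real.sin a * cosMoment x a - Real.cos a * sinMoment x a) from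
          intervalIntegral.integral_interval_sub_left (iD _ _) (iD _ _),
        ← intervalIntegral.integral_sub (iD _ _) ((iS _ _).mul_const _),
        ← intervalIntegral.integral_add ((iD _ _).sub ((iS _ _).mul_const _))
          ((iC _ _).mul_const _)]
      congr 1
      funext a
      ring
    simp only [eD]
    rw [Metric.tendsto_atTop] at hx ⊢
    intro ε hε
    -- The double integral is at most `2 δ² T²`. The cap `δ ≤ 1` turns `δ²` into `δ`, and the extra
    -- `+ 1` makes the final inequality strict.
    set δ := min 1 (ε / (2 * T * T + 1)) with hδ
    have hδ0 : 0 < δ := lt_min one_pos (by positivity)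
    obtain ⟨R, hR⟩ := hx δ hδ0
    refine ⟨R + T, fun t ht => ?_⟩
    have hbx : ∀ a, t - T ≤ a → |x a| ≤ δ := fun a ha => by
      have := hR a (by linarith)
      rw [dist_zero_right] at this
      exact this.le
    have hb : ∀ {h : ℝ → ℝ}, (∀ a, |h a| ≤ 1) → ∀ a ∈ Set.Icc (t - T) t,
        |∫ b in (t - T)..a, x b * h b| ≤ δ * T := fun {h} hh a ha => by
      have h3 : ∀ b ∈ Set.uIoc (t - T) a, ‖x b * h b‖ ≤ δ := fun b hb => by
        rw [Set.uIoc_of_le ha.1] at hb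
        rw [norm_mul]
        calc |x b| * |h b| ≤ δ * 1 := by
              gcongr
              · exact hbx b hb.1.le
              · exact hh b
          _ = δ := mul_one δ
      refine (intervalIntegral.norm_integral_le_of_norm_le_const h3).trans ?_
      rw [abs_of_nonneg (by linarith [ha.1])]
      exact mul_le_mul_of_nonneg_left (by linarith [ha.2]) hδ0.le
    have h4 : ∀ a ∈ Set.uIoc (t - T) t, ‖x a * (Real.sin a * (cosMoment x a
        - cosMoment x (t - T)) - Real.cos a * (sinMoment x a - sinMoment x (t - T)))‖
        ≤ δ * (2 * (δ * T)) := fun a ha => by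
      rw [Set.uIoc_of_le (by linarith)] at ha
      rw [norm_mul]
      refine mul_le_mul (hbx a ha.1.le) ?_ (norm_nonneg _) hδ0.le
      refine (norm_sub_le _ _).trans ?_
      rw [norm_mul, norm_mul, eC, eS]
      have ha' := Set.Ioc_subset_Icc_self ha
      have u1 := hb Real.abs_cos_le_one a ha'
      have u2 := hb Real.abs_sin_le_one a ha'
      have u3 := mul_le_mul (Real.abs_sin_le_one a) u1 (abs_nonneg _) zero_le_one
      have u4 := mul_le_mul (Real.abs_cos_le_one a) u2 (abs_nonneg _) zero_le_one
      simp only [Real.norm_eq_abs]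
      linarith
    rw [dist_zero_right]
    refine (intervalIntegral.norm_integral_le_of_norm_le_const h4).trans_lt ?_
    rw [sub_sub_cancel, abs_of_nonneg hT]
    have hδ1 : δ ≤ 1 := min_le_left _ _
    have hδ2 : δ * (2 * T * T + 1) ≤ ε :=
      (le_div_iff₀ (by positivity)).1 (min_le_right _ _)
    have : δ * δ ≤ δ := by nlinarith
    nlinarith [mul_nonneg hT hT, mul_le_mul_of_nonneg_right this (mul_nonneg hT hT)]
  have hcp : ∀ t, |Real.cos (t - T)| ≤ 1 := fun t => Real.abs_cos_le_one _
  have hsp : ∀ t, |Real.sin (t - T)| ≤ 1 := fun t => Real.abs_sin_le_one _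
  have key := ((((hx.pow 2).const_mul A).sub ((hx.const_mul 2).mul
    ((((mul_bdd hC hcp).add (mul_bdd hS hsp)).const_mul A).sub
      (((mul_bdd hS hcp).sub (mul_bdd hC hsp)).const_mul (1 / 2))))).add
    (((hC.pow 2).add (hS.pow 2)).const_mul A)).sub hD
  simpa using key.congr fun t => (rfl : _ = lyapunov A T x t)

theorem IsFundamental.tendsto_unit {T : ℝ} (hT : 0 ≤ T) (hT' : T < Real.pi / 2) {x : ℝ → ℝ}
    (hx : IsFundamental 1 T x) :
    Tendsto x atTop (𝓝 0) ∧ Tendsto (fun t => ∫ s in (0 : ℝ)..t, x s ^ 2) atTop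
      (𝓝 (Real.cos T / (2 * (1 - Real.sin T)))) := by
  have hc := hx.toIsCausal
  have hcos : 0 < Real.cos T := Real.cos_pos_of_mem_Ioo ⟨by linarith, hT'⟩
  have hsq := Real.sin_sq_add_cos_sq T
  have hsin : 0 < 1 - Real.sin T := by nlinarith [Real.sin_le_one T, Real.neg_one_le_sin T]
  set A := Real.cos T / (2 * (1 - Real.sin T)) with hA
  have h2 : 2 * A * (1 - Real.sin T) = Real.cos T := by
    rw [hA]
    field_simp
  have h1 : 2 * A * Real.cos T = 1 + Real.sin T := by
    rw [hA]
    field_simp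
    linarith
  have hid := fun t ht => integral_sq_add_lyapunov hT h1 h2 hx (t := t) ht
  have hxi : ∀ a b, IntervalIntegrable (fun s => x s ^ 2) volume a b := fun a b =>
    (show IsCausal fun s => x s ^ 2 from
      ⟨fun t ht => by simp [hc.neg t ht], hc.cont.pow 2⟩).intervalIntegrable a b
  -- Positivity of `V` bounds all partial energies by `A`.
  have hI : IntegrableOn (fun s => x s ^ 2) (Set.Ioi 0) := by
    refine integrableOn_Ioi_of_intervalIntegral_norm_bounded A 0
      (fun t => (intervalIntegrable_iff.1 (hxi 0 t)).mono_set Set.Ioc_subset_uIoc)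
      tendsto_id ?_
    filter_upwards [eventually_ge_atTop 0] with t ht
    have := hid t ht
    have := lyapunov_nonneg hT hT' h1 h2 hc t
    simp only [norm_pow, Real.norm_eq_abs, sq_abs]
    linarith
  have hI' : IntegrableOn (fun s => x s ^ 2) Set.univ := by
    rw [← Set.Iio_union_Ici (a := (0 : ℝ))]
    refine IntegrableOn.union ?_ (integrableOn_Ici_iff_integrableOn_Ioi (by simp) |>.2 hI)
    refine integrableOn_zero.congr_fun (fun s hs => ?_) measurableSet_Iio
    simp [hc.neg s hs]
  rw [integrableOn_univ] at hI'
  have hI'' : Integrable fun s => x (s - T) ^ 2 := hI'.comp_sub_right T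
  -- This is the derivative of `x²`, dominated by `x(s)² + x(s-T)²`. An integrable function with
  -- integrable derivative tends to `0`.
  have hprod : Integrable fun s => 2 * x s * -x (s - T) := by
    refine (hI'.add hI'').mono' ?_ (ae_of_all _ fun s => ?_)
    · exact (((hc.measurable.const_mul 2).mul
        (hc.measurable.comp (measurable_id.sub_const T)).neg)).aestronglyMeasurable
    · rw [Real.norm_eq_abs, abs_le]
      simp only [Pi.add_apply]
      constructor <;> nlinarith [sq_nonneg (x s - x (s - T)), sq_nonneg (x s + x (s - T))]
  have hsq0 : Tendsto (fun s => x s ^ 2) atTop (𝓝 0) := by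
    refine tendsto_zero_of_hasDerivAt_of_integrableOn_Ioi (a := T)
      (f' := fun s => 2 * x s * -x (s - T)) (fun s hs => ?_) hprod.integrableOn hI'.integrableOn
    exact ((hx.hasDerivAt (hT.trans_lt hs) (ne_of_gt hs)).pow 2).congr_deriv (by simp)
  have hx0 : Tendsto x atTop (𝓝 0) := by
    have := hsq0.sqrt
    simp only [Real.sqrt_sq_eq_abs, Real.sqrt_zero] at this
    exact (tendsto_zero_iff_abs_tendsto_zero _).2 this
  refine ⟨hx0, ?_⟩
  have := (tendsto_lyapunov (A := A) hT hc hx0).const_sub A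
  rw [sub_zero] at this
  refine this.congr' ?_
  filter_upwards [eventually_ge_atTop 0] with t ht
  linarith [hid t ht]

/-- Decay and energy of the fundamental solution in the stability range `0 ≤ τ lam < π / 2`. -/
theorem IsFundamental.tendsto {lam τ : ℝ} (hlam : 0 < lam) (hτ : 0 ≤ τ)
    (hs : τ * lam < Real.pi / 2) {φ : ℝ → ℝ} (hφ : IsFundamental lam τ φ) :
    Tendsto φ atTop (𝓝 0) ∧ Tendsto (fun t => ∫ s in (0 : ℝ)..t, φ s ^ 2) atTop
      (𝓝 (Real.cos (lam * τ) / (2 * lam * (1 - Real.sin (lam * τ))))) := by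
  -- Measuring time in units of `1 / lam` normalises the gain and turns the delay into `lam τ`.
  have hx : IsFundamental 1 (lam * τ) fun t => φ (t / lam) := by
    refine ⟨⟨fun t ht => hφ.neg _ (div_neg_of_neg_of_pos ht hlam), ?_⟩, fun t ht => ?_⟩
    · exact hφ.cont.comp (by fun_prop) fun t ht => div_nonneg ht hlam.le
    · rw [hφ.equation _ (div_nonneg ht hlam.le), one_mul]
      have := intervalIntegral.integral_comp_div (a := 0) (b := t) (fun s => φ (s - τ)) hlam.ne'
      rw [zero_div, smul_eq_mul] at this
      rw [← this]
      congr 2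
      funext s
      congr 1
      field_simp
  obtain ⟨h1, h2⟩ := hx.tendsto_unit (by positivity) (by linarith)
  have hmul : Tendsto (fun t : ℝ => t * lam) atTop atTop := tendsto_id.atTop_mul_const hlam
  refine ⟨(h1.comp hmul).congr fun t => ?_, ?_⟩
  · simp only [Function.comp_apply]
    rw [mul_div_cancel_right₀ _ hlam.ne']
  · have h3 := (h2.comp hmul).const_mul lam⁻¹
    rw [show Real.cos (lam * τ) / (2 * lam * (1 - Real.sin (lam * τ)))
      = lam⁻¹ * (Real.cos (lam * τ) / (2 * (1 - Real.sin (lam * τ)))) by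
        rw [inv_mul_eq_div, div_div]; ring_nf]
    refine h3.congr fun t => ?_
    simp only [Function.comp_apply]
    have := intervalIntegral.integral_comp_div (a := 0) (b := t * lam) (fun s => φ s ^ 2)
      hlam.ne'
    rw [zero_div, mul_div_cancel_right₀ _ hlam.ne', smul_eq_mul] at this
    rw [this, inv_mul_cancel_left₀ hlam.ne']

/-! ### Second moments of path integrals of a process -/

section PathIntegral

variable {Ω : Type*} [MeasurableSpace Ω] {P : Measure Ω}

/-- A process with almost surely continuous paths is jointly almost everywhere measurable. -/
theorem aestronglyMeasurable_uncurry_of_continuous {N : ℝ → Ω → ℝ}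
    (hm : ∀ s, AEMeasurable (N s) P) (hc : ∀ᵐ ω ∂P, Continuous fun s => N s ω)
    (ν : Measure ℝ) [SFinite ν] :
    AEStronglyMeasurable (Function.uncurry N) (ν.prod P) := by
  classical
  -- Countably many rational times can be controlled off one null set; path continuity then
  -- determines all other times.
  have hgood : ∀ᵐ ω ∂P, (Continuous fun s => N s ω)
      ∧ ∀ q : ℚ, N (q : ℝ) ω = (hm (q : ℝ)).mk _ ω :=
    hc.and (ae_all_iff.2 fun q => (hm (q : ℝ)).ae_eq_mk)
  obtain ⟨S, hS, hSP⟩ := eventually_iff_exists_mem.1 hgood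
  set Z := toMeasurable P Sᶜ with hZ
  have hZ0 : P Z = 0 := by rw [hZ, measure_toMeasurable]; exact hS
  have hZm : MeasurableSet Z := measurableSet_toMeasurable _ _
  have hZS : ∀ ω, ω ∉ Z → ω ∈ S := fun ω hω => by
    by_contra h
    exact hω (subset_toMeasurable P _ h)
  set N' : ℝ → Ω → ℝ := fun s => Zᶜ.indicator (N s) with hN'
  have hq : ∀ q : ℚ, Measurable (N' (q : ℝ)) := fun q => by
    have : N' (q : ℝ) = Zᶜ.indicator ((hm (q : ℝ)).mk _) := by
      funext ω
      by_cases h : ω ∈ Z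
      · simp [hN', h]
      · simp only [hN', Set.indicator_of_mem (show ω ∈ Zᶜ from h)]
        exact (hSP ω (hZS ω h)).2 q
    rw [this]
    exact (hm (q : ℝ)).measurable_mk.indicator hZm.compl
  have hcont : ∀ ω, Continuous fun s => N' s ω := fun ω => by
    by_cases h : ω ∈ Z
    · simp only [hN', Set.indicator_of_notMem (show ω ∉ Zᶜ from fun h' => h' h)]
      exact continuous_const
    · simp only [hN', Set.indicator_of_mem (show ω ∈ Zᶜ from h)]
      exact (hSP ω (hZS ω h)).1
  have hmeas : ∀ s, Measurable (N' s) := fun s => by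
    obtain ⟨u, hu, hus⟩ := mem_closure_iff_seq_limit.1 (Rat.denseRange_cast (𝕜 := ℝ) s)
    choose q hq' using hu
    refine measurable_of_tendsto_metrizable (f := fun n => N' (u n)) (fun n => ?_)
      (tendsto_pi_nhds.2 fun ω => ((hcont ω).tendsto s).comp hus)
    rw [← hq' n]
    exact hq (q n)
  have hjoint : StronglyMeasurable (Function.uncurry N') :=
    stronglyMeasurable_uncurry_of_continuous_of_stronglyMeasurable hcont
      fun s => (hmeas s).stronglyMeasurable
  refine ⟨Function.uncurry N', hjoint, ?_⟩
  have hae : ∀ᵐ ω ∂P, ω ∉ Z := measure_eq_zero_iff_ae_notMem.1 hZ0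
  filter_upwards [Measure.quasiMeasurePreserving_snd.ae hae] with a ha
  simp only [Function.uncurry, hN', Set.indicator_of_mem (show a.2 ∈ Zᶜ from ha)]

variable [IsProbabilityMeasure P] {ν : Measure ℝ} [IsFiniteMeasure ν] {F : ℝ → Ω → ℝ}

/-- The path integral of a square-integrable process is square-integrable. -/
theorem memLp_two_integral (hF : MemLp (Function.uncurry F) 2 (ν.prod P)) :
    MemLp (fun ω => ∫ s, F s ω ∂ν) 2 P := by
  have hm : AEStronglyMeasurable (fun ω => ∫ s, F s ω ∂ν) P :=
    hF.aestronglyMeasurable.prod_swap.integral_prod_right'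
  rw [memLp_two_iff_integrable_sq hm]
  have hsq := (memLp_two_iff_integrable_sq hF.aestronglyMeasurable).1 hF
  have h1 : Integrable (Function.uncurry F) (ν.prod P) :=
    hF.integrable one_le_two
  refine ((hsq.integral_prod_right).const_mul (ν.real Set.univ)).mono' (hm.pow 2) ?_
  filter_upwards [hsq.prod_left_ae, h1.prod_left_ae] with ω hω hω'
  simp only [Function.uncurry_apply_pair] at hω hω' ⊢
  rw [Real.norm_of_nonneg (sq_nonneg _)]
  set J := ∫ s, F s ω ∂ν with hJ
  set M := ν.real Set.univ with hM
  have hM0 : 0 ≤ M := measureReal_nonneg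
  -- Cauchy–Schwarz, `J² ≤ M ∫ F²`, in the form of the nonnegative integral of `(M F - J)²`; the
  -- case `M = 0` is treated apart.
  have h0 : 0 ≤ ∫ s, (M * F s ω - J) ^ 2 ∂ν := integral_nonneg fun s => sq_nonneg _
  have e : ∫ s, (M * F s ω - J) ^ 2 ∂ν
      = M ^ 2 * (∫ s, F s ω ^ 2 ∂ν) - 2 * M * J * J + M * J ^ 2 := by
    have : (fun s => (M * F s ω - J) ^ 2)
        = fun s => M ^ 2 * F s ω ^ 2 - 2 * M * J * F s ω + J ^ 2 := by
      funext s
      ring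
    rw [this, integral_add (f := fun s => M ^ 2 * F s ω ^ 2 - 2 * M * J * F s ω)
      ((hω.const_mul _).sub (hω'.const_mul _)) (integrable_const _), integral_sub (hω.const_mul _) (hω'.const_mul _), integral_const_mul, integral_const_mul,
      integral_const, smul_eq_mul]
  rw [e] at h0
  rcases hM0.eq_or_lt with h | h
  · have : ν = 0 := by
      rw [← Measure.measure_univ_eq_zero]
      exact (measureReal_eq_zero_iff).1 h.symm
    simp [hJ, this]
  · have : 0 ≤ M * (M * (∫ s, F s ω ^ 2 ∂ν) - J ^ 2) := by linarith
    linarith [nonneg_of_mul_nonneg_right this h]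

/-- Expectation and path integration commute, against a square-integrable weight. -/
theorem integral_mul_integral_swap (hF : MemLp (Function.uncurry F) 2 (ν.prod P)) {H : Ω → ℝ}
    (hH : MemLp H 2 P) :
    ∫ ω, H ω * ∫ s, F s ω ∂ν ∂P = ∫ s, ∫ ω, H ω * F s ω ∂P ∂ν := by
  have h1 : MemLp (fun a : ℝ × Ω => H a.2) 2 (ν.prod P) := hH.comp_snd ν
  have h2 : Integrable (fun a : ℝ × Ω => H a.2 * F a.1 a.2) (ν.prod P) := h1.integrable_mul hF
  rw [integral_integral_swap (f := fun s ω => H ω * F s ω) h2]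
  simp only [integral_const_mul]

end PathIntegral

/-! ### Wiener integrals against processes with Brownian covariance -/

/-- A centred square-integrable process with almost surely continuous paths and the covariance
`b min(s, r)` of a Brownian motion of intensity `b`. -/
structure IsBrownianLike {Ω : Type*} [MeasurableSpace Ω] (N : ℝ → Ω → ℝ) (b : ℝ)
    (P : Measure Ω) : Prop where
  memLp : ∀ s, MemLp (N s) 2 P
  continuous : ∀ᵐ ω ∂P, Continuous fun s => N s ω
  mean : ∀ s, ∫ ω, N s ω ∂P = 0
  cov : ∀ s r, 0 ≤ s → 0 ≤ r → ∫ ω, N s ω * N r ω ∂P = b * min s r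

section Calculus

variable {Ψ g : ℝ → ℝ} {t : ℝ} {S : Set ℝ}

/-- Integration by parts for `Ψ' = g` against the Brownian covariance, whose slope in `r` is `1` up
to `s` and `0` after. It yields the covariance of `N(s)` with the Wiener integral. -/
theorem integral_mul_min_add (hΨ : Continuous Ψ) (hg : IntervalIntegrable g volume 0 t)
    (hS : S.Countable) (hd : ∀ s ∈ Set.Ioo 0 t \ S, HasDerivAt Ψ (g s) s) (ht1 : Ψ t = 1)
    {s : ℝ} (hs : s ∈ Set.Icc 0 t) :
    (∫ r in (0 : ℝ)..t, g r * min s r) + ∫ r in (0 : ℝ)..s, Ψ r = s := by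
  have hg1 : IntervalIntegrable g volume 0 s := hg.mono_set (by
    rw [Set.uIcc_of_le hs.1, Set.uIcc_of_le (hs.1.trans hs.2)]
    exact Set.Icc_subset_Icc_right hs.2)
  have hg2 : IntervalIntegrable g volume s t := hg.mono_set (by
    rw [Set.uIcc_of_le hs.2, Set.uIcc_of_le (hs.1.trans hs.2)]
    exact Set.Icc_subset_Icc_left hs.1)
  have hmin : Continuous fun r : ℝ => min s r := by fun_prop
  rw [← intervalIntegral.integral_add_adjacent_intervals (hg1.mul_continuousOn hmin.continuousOn)
    (hg2.mul_continuousOn hmin.continuousOn)]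
  have e1 : ∫ r in (0 : ℝ)..s, g r * min s r = ∫ r in (0 : ℝ)..s, g r * r := by
    refine intervalIntegral.integral_congr fun r hr => ?_
    rw [Set.uIcc_of_le hs.1] at hr
    simp only [min_eq_right hr.2]
  have e2 : ∫ r in s..t, g r * min s r = ∫ r in s..t, g r * s := by
    refine intervalIntegral.integral_congr fun r hr => ?_
    rw [Set.uIcc_of_le hs.2] at hr
    simp only [min_eq_left hr.1]
  have hgr : IntervalIntegrable (fun r => g r * r) volume 0 s :=
    hg1.mul_continuousOn continuousOn_id
  have f1 := integral_eq_of_hasDerivAt_off_countable (fun r => Ψ r * r)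
    (fun r => g r * r + Ψ r) (a := 0) (b := s) hS (by fun_prop) (fun r hr => ?_)
    (hgr.add (hΨ.intervalIntegrable _ _))
  · have f2 := integral_eq_of_hasDerivAt_off_countable Ψ g (a := s) (b := t) hS
      hΨ.continuousOn (fun r hr => ?_) hg2
    · rw [intervalIntegral.integral_add hgr (hΨ.intervalIntegrable _ _)] at f1
      rw [e1, e2, intervalIntegral.integral_mul_const, f2, ht1]
      linarith
    · rw [min_eq_left hs.2, max_eq_right hs.2] at hr
      exact hd r ⟨⟨hs.1.trans_lt hr.1.1, hr.1.2⟩, hr.2⟩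
  · rw [min_eq_left hs.1, max_eq_right hs.1] at hr
    exact ((hd r ⟨⟨hr.1.1, hr.1.2.trans_le hs.2⟩, hr.2⟩).mul (hasDerivAt_id r)).congr_deriv
      (by simp)

/-- The second integration by parts, which turns that covariance into the variance `∫ Ψ²`. -/
theorem integral_mul_primitive_add (ht : 0 ≤ t) (hΨ : Continuous Ψ)
    (hg : IntervalIntegrable g volume 0 t) (hS : S.Countable)
    (hd : ∀ s ∈ Set.Ioo 0 t \ S, HasDerivAt Ψ (g s) s) (ht1 : Ψ t = 1) :
    (∫ r in (0 : ℝ)..t, g r * ∫ u in (0 : ℝ)..r, Ψ u) + ∫ r in (0 : ℝ)..t, Ψ r ^ 2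
      = ∫ r in (0 : ℝ)..t, Ψ r := by
  have hm : ∀ r, HasDerivAt (fun r => ∫ u in (0 : ℝ)..r, Ψ u) (Ψ r) r := fun r =>
    hΨ.integral_hasStrictDerivAt 0 r |>.hasDerivAt
  have hmc : Continuous fun r => ∫ u in (0 : ℝ)..r, Ψ u :=
    continuous_iff_continuousAt.2 fun r => (hm r).continuousAt
  have hgm := hg.mul_continuousOn hmc.continuousOn
  have hsq : Continuous fun r => Ψ r ^ 2 := by fun_prop
  have f1 := integral_eq_of_hasDerivAt_off_countable (fun r => Ψ r * ∫ u in (0 : ℝ)..r, Ψ u)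
    (fun r => g r * (∫ u in (0 : ℝ)..r, Ψ u) + Ψ r ^ 2) (a := 0) (b := t) hS
    (hΨ.mul hmc).continuousOn (fun r hr => ?_) (hgm.add (hsq.intervalIntegrable _ _))
  · rw [intervalIntegral.integral_add hgm (hsq.intervalIntegrable _ _), ht1] at f1
    simpa using f1
  · rw [min_eq_left ht, max_eq_right ht] at hr
    exact ((hd r hr).mul (hm r)).congr_deriv (by ring)

end Calculus

namespace IsBrownianLike

variable {Ω : Type*} [MeasurableSpace Ω] {P : Measure Ω} [IsProbabilityMeasure P]
  {N : ℝ → Ω → ℝ} {b : ℝ} {g : ℝ → ℝ} {t K : ℝ}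

theorem memLp_uncurry (hN : IsBrownianLike N b P) (hg : Measurable g)
    (hK : ∀ s ∈ Set.Ioc 0 t, |g s| ≤ K) :
    MemLp (Function.uncurry fun s ω => g s * N s ω) 2
      ((volume.restrict (Set.Ioc 0 t)).prod P) := by
  have hm : AEStronglyMeasurable (Function.uncurry fun s ω => g s * N s ω)
      ((volume.restrict (Set.Ioc 0 t)).prod P) :=
    (hg.comp measurable_fst).aestronglyMeasurable.mul
      (aestronglyMeasurable_uncurry_of_continuous (fun s => (hN.memLp s).aemeasurable)
        hN.continuous _)
  rw [memLp_two_iff_integrable_sq hm, integrable_prod_iff (by exact hm.pow 2)]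
  simp only [Function.uncurry_apply_pair, mul_pow, norm_mul, norm_pow,
    Real.norm_eq_abs, sq_abs]
  have hsq : ∀ s, Integrable (fun ω => N s ω ^ 2) P := fun s => (hN.memLp s).integrable_sq
  refine ⟨ae_of_all _ fun s => (hsq s).const_mul _, ?_⟩
  have hval : ∀ s ∈ Set.Ioc 0 t, ∫ ω, g s ^ 2 * N s ω ^ 2 ∂P = g s ^ 2 * (b * s) := by
    intro s hs
    have := hN.cov s s hs.1.le hs.1.le
    rw [min_self] at this
    rw [integral_const_mul, ← this]
    congr 2
    funext ω
    ring
  have : IntegrableOn (fun s => g s ^ 2 * (b * s)) (Set.Ioc 0 t) := by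
    refine Measure.integrableOn_of_bounded (M := K ^ 2 * (|b| * t)) (by simp)
      ((hg.pow_const 2).mul (by fun_prop)).aestronglyMeasurable ?_
    refine (ae_restrict_iff' measurableSet_Ioc).2 (ae_of_all _ fun s hs => ?_)
    have h1 := hK s hs
    rw [norm_mul, norm_mul, norm_pow, Real.norm_eq_abs, Real.norm_eq_abs, Real.norm_eq_abs,
      abs_of_pos hs.1]
    gcongr
    · exact mul_nonneg (abs_nonneg _) hs.1.le
    · exact hs.2
  exact this.congr_fun (fun s hs => (hval s hs).symm) measurableSet_Ioc

variable {Ψ : ℝ → ℝ} {S : Set ℝ}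

/-- Mean and variance of the Wiener integral `∫₀ᵗ Ψ dN`, written after integration by parts as
`N(t) - ∫₀ᵗ Ψ' N`, for a weight with `Ψ(t) = 1`. -/
theorem moments_sub_integral (hN : IsBrownianLike N b P) (ht : 0 ≤ t) (hg : Measurable g)
    (hK : ∀ s ∈ Set.Ioc 0 t, |g s| ≤ K) (hΨ : Continuous Ψ) (hS : S.Countable)
    (hd : ∀ s ∈ Set.Ioo 0 t \ S, HasDerivAt Ψ (g s) s) (ht1 : Ψ t = 1) :
    MemLp (fun ω => N t ω - ∫ s in (0 : ℝ)..t, g s * N s ω) 2 P ∧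
    ∫ ω, (N t ω - ∫ s in (0 : ℝ)..t, g s * N s ω) ∂P = 0 ∧
    ∫ ω, (N t ω - ∫ s in (0 : ℝ)..t, g s * N s ω) ^ 2 ∂P
      = b * ∫ s in (0 : ℝ)..t, Ψ s ^ 2 := by
  have hF := hN.memLp_uncurry (t := t) hg hK
  have hgi : IntervalIntegrable g volume 0 t := by
    rw [intervalIntegrable_iff, Set.uIoc_of_le ht]
    exact Measure.integrableOn_of_bounded (M := K) (by simp) hg.aestronglyMeasurable
      ((ae_restrict_iff' measurableSet_Ioc).2 (ae_of_all _ hK))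
  have hJ := memLp_two_integral hF
  simp only [← intervalIntegral.integral_of_le ht] at hJ
  have hswap : ∀ {H : Ω → ℝ}, MemLp H 2 P → ∫ ω, H ω * (∫ s in (0 : ℝ)..t, g s * N s ω) ∂P
      = ∫ s in (0 : ℝ)..t, g s * ∫ ω, H ω * N s ω ∂P := fun {H} hH => by
    have := integral_mul_integral_swap hF hH
    simp only [← intervalIntegral.integral_of_le ht] at this
    rw [this]
    congr 1
    funext s
    rw [← integral_const_mul]
    congr 1
    funext ω
    ring
  have hY : MemLp (fun ω => N t ω - ∫ s in (0 : ℝ)..t, g s * N s ω) 2 P := (hN.memLp t).sub hJ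
  set Y : Ω → ℝ := fun ω => N t ω - ∫ s in (0 : ℝ)..t, g s * N s ω with hYdef
  refine ⟨hY, ?_, ?_⟩
  · rw [hYdef, integral_sub ((hN.memLp t).integrable one_le_two) (hJ.integrable one_le_two),
      hN.mean]
    have := hswap (memLp_const (1 : ℝ))
    simp only [one_mul, hN.mean, mul_zero, intervalIntegral.integral_zero] at this
    rw [this, sub_zero]
  -- The variance is computed one factor at a time: `E[Y N(s)] = b ∫₀ˢ Ψ`, and then `Y` is paired
  -- with its own definition.
  · have hcross : ∀ s ∈ Set.Icc 0 t, ∫ ω, Y ω * N s ω ∂P = b * ∫ r in (0 : ℝ)..s, Ψ r := by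
      intro s hs
      have e : (fun ω => Y ω * N s ω)
          = fun ω => N s ω * N t ω - N s ω * ∫ r in (0 : ℝ)..t, g r * N r ω := by
        funext ω
        rw [hYdef]
        ring
      rw [e, integral_sub (by exact (hN.memLp s).integrable_mul (hN.memLp t))
        (by exact (hN.memLp s).integrable_mul hJ), hswap (hN.memLp s), hN.cov s t hs.1 ht,
        min_eq_left hs.2]
      have e2 : ∫ r in (0 : ℝ)..t, g r * ∫ ω, N s ω * N r ω ∂P
          = ∫ r in (0 : ℝ)..t, b * (g r * min s r) := by
        refine intervalIntegral.integral_congr fun r hr => ?_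
        rw [Set.uIcc_of_le ht] at hr
        simp only [hN.cov s r hs.1 hr.1]
        ring
      rw [e2, intervalIntegral.integral_const_mul]
      linear_combination -b * integral_mul_min_add hΨ hgi hS hd ht1 hs
    have e : (fun ω => Y ω ^ 2)
        = fun ω => Y ω * N t ω - Y ω * ∫ r in (0 : ℝ)..t, g r * N r ω := by
      funext ω
      rw [hYdef]
      ring
    have e2 : ∫ r in (0 : ℝ)..t, g r * ∫ ω, Y ω * N r ω ∂P
        = ∫ r in (0 : ℝ)..t, b * (g r * ∫ u in (0 : ℝ)..r, Ψ u) := by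
      refine intervalIntegral.integral_congr fun r hr => ?_
      rw [Set.uIcc_of_le ht] at hr
      simp only [hcross r hr]
      ring
    change ∫ ω, Y ω ^ 2 ∂P = _
    rw [e, integral_sub (by exact hY.integrable_mul (hN.memLp t))
      (by exact hY.integrable_mul hJ), hswap hY,
      hcross t ⟨ht, le_rfl⟩, e2, intervalIntegral.integral_const_mul]
    linear_combination -b * integral_mul_primitive_add ht hΨ hgi hS hd ht1

/-- Second moment of the solution of the scalar delay equation with additive noise. -/
theorem secondMoment {lam τ : ℝ} (hτ : 0 ≤ τ) {φ : ℝ → ℝ} (hφ : IsFundamental lam τ φ)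
    (hN : IsBrownianLike N b P) {z : ℝ → Ω → ℝ} {z₀ : ℝ} (hz : ∀ᵐ ω ∂P, IsCausal fun t => z t ω)
    (heq : ∀ᵐ ω ∂P, ∀ t, 0 ≤ t →
      z t ω = z₀ - lam * (∫ s in (0 : ℝ)..t, z (s - τ) ω) + N t ω) {t : ℝ} (ht : 0 ≤ t) :
    Integrable (fun ω => z t ω ^ 2) P ∧
    ∫ ω, z t ω ^ 2 ∂P = φ t ^ 2 * z₀ ^ 2 + b * ∫ s in (0 : ℝ)..t, φ s ^ 2 := by
  set g : ℝ → ℝ := fun s => lam * φ (t - s - τ) with hg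
  -- The weight is `φ(t - s)`, frozen at `φ(0) = 1` for `s > t` so that it is continuous on the
  -- whole line; `g` is its derivative on `(0, t)` off `t - τ`.
  set Ψ : ℝ → ℝ := fun s => φ (max (t - s) 0) with hΨ
  have hc := hφ.toIsCausal
  obtain ⟨K, -, hK⟩ := hc.exists_bound t
  obtain ⟨hY, hY1, hY2⟩ := hN.moments_sub_integral (g := g) (Ψ := Ψ) (t := t)
    (K := |lam| * K) (S := {t - τ}) ht
    ((hc.measurable.comp (by fun_prop)).const_mul lam)
    (fun s hs => by
      rw [hg, abs_mul]
      exact mul_le_mul_of_nonneg_left (hK _ (by linarith [hs.1])) (abs_nonneg _))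
    (hc.continuous_max.comp (by fun_prop)) (Set.countable_singleton _)
    (fun s hs => by
      have h1 : HasDerivAt (fun s => φ (t - s)) (lam * φ (t - s - τ)) s := by
        have := (hφ.hasDerivAt (t := t - s) (by linarith [hs.1.2])
          (fun h => hs.2 (by simp; linarith))).comp_const_sub t s
        simpa using this
      refine h1.congr_of_eventuallyEq ?_
      filter_upwards [Iio_mem_nhds hs.1.2] with r hr
      rw [hΨ]
      simp only [max_eq_left (sub_nonneg.2 (Set.mem_Iio.1 hr).le)])
    (by simp [hΨ, hφ.zero])
  set Y : Ω → ℝ := fun ω => N t ω - ∫ s in (0 : ℝ)..t, g s * N s ω with hYdef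
  have hzY : ∀ᵐ ω ∂P, z t ω ^ 2 = φ t ^ 2 * z₀ ^ 2 + 2 * φ t * z₀ * Y ω + Y ω ^ 2 := by
    filter_upwards [hz, heq, hN.continuous] with ω h1 h2 h3
    have := hφ.variation_of_constants hτ h1 h3.continuousOn h2 ht
    rw [this, hYdef]
    simp only [hg, mul_assoc, intervalIntegral.integral_const_mul]
    ring
  have i1 : Integrable (fun ω => φ t ^ 2 * z₀ ^ 2 + 2 * φ t * z₀ * Y ω) P :=
    (integrable_const _).add ((hY.integrable one_le_two).const_mul _)
  refine ⟨(i1.add hY.integrable_sq).congr (hzY.mono fun ω h => h.symm), ?_⟩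
  rw [integral_congr_ae hzY, integral_add i1 hY.integrable_sq,
    integral_add (integrable_const _) ((hY.integrable one_le_two).const_mul _),
    integral_const_mul (2 * φ t * z₀), hY1, hY2]
  have : ∫ s in (0 : ℝ)..t, Ψ s ^ 2 = ∫ s in (0 : ℝ)..t, φ s ^ 2 := by
    have h := intervalIntegral.integral_comp_sub_left (a := 0) (b := t)
      (fun s => φ (max s 0) ^ 2) t
    simp only [sub_self, sub_zero] at h
    rw [hΨ, h]
    refine intervalIntegral.integral_congr fun s hs => ?_
    rw [Set.uIcc_of_le ht] at hs
    simp only [max_eq_left hs.1]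
  rw [this]
  simp

end IsBrownianLike

/-- A linear combination of independent Brownian motions has the covariance of a Brownian motion
whose intensity is the sum of the squared coefficients. -/
theorem IsIndepBrownian.isBrownianLike_sum {ι Ω : Type*} [Fintype ι] [MeasurableSpace Ω]
    {P : Measure Ω} [IsProbabilityMeasure P] {W : ι → ℝ≥0 → Ω → ℝ} (hW : IsIndepBrownian W P)
    (c : ι → ℝ) :
    IsBrownianLike (fun s ω => ∑ k, c k * W k s.toNNReal ω) (∑ k, c k ^ 2) P := by
  classical
  have hL : ∀ k s, MemLp (W k s) 2 P := fun k s =>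
    ((hW.brownian k).hasLaw_eval s).hasGaussianLaw.memLp_two
  have h0 : ∀ k s, ∫ ω, W k s ω ∂P = 0 := fun k s => (hW.brownian k).integral_eval s
  have hcov : ∀ k l s r, ∫ ω, W k s ω * W l r ω ∂P = if k = l then ((min s r : ℝ≥0) : ℝ) else 0 := by
    intro k l s r
    have e := covariance_eq_sub (hL k s) (hL l r)
    rw [h0, h0, mul_zero, sub_zero] at e
    change _ = ∫ ω, W k s ω * W l r ω ∂P at e
    rw [← e]
    split_ifs with h
    · subst h
      exact (hW.brownian k).covariance_eval s r
    · have hi := (hW.indep.indepFun h).comp (measurable_pi_apply s) (measurable_pi_apply r)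
      exact hi.covariance_eq_zero (hL k s) (hL l r)
  refine ⟨fun s => ?_, ?_, fun s => ?_, fun s r hs hr => ?_⟩
  · exact memLp_finsetSum _ fun k _ => (hL k _).const_mul (c k)
  · have : ∀ᵐ ω ∂P, ∀ k, Continuous fun s => W k s ω :=
      ae_all_iff.2 fun k => (hW.brownian k).cont
    filter_upwards [this] with ω hω
    exact continuous_finsetSum _ fun k _ =>
      continuous_const.mul ((hω k).comp continuous_real_toNNReal)
  · rw [integral_finsetSum _ fun k _ => ((hL k _).integrable one_le_two).const_mul _]
    simp [integral_const_mul, h0]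
  · have e : (fun ω => (∑ k, c k * W k s.toNNReal ω) * ∑ l, c l * W l r.toNNReal ω)
        = fun ω => ∑ k, ∑ l, c k * c l * (W k s.toNNReal ω * W l r.toNNReal ω) := by
      funext ω
      rw [Finset.sum_mul_sum]
      refine Finset.sum_congr rfl fun k _ => Finset.sum_congr rfl fun l _ => by ring
    have hi : ∀ k l, Integrable (fun ω => c k * c l
        * (W k s.toNNReal ω * W l r.toNNReal ω)) P := fun k l =>
      ((hL k _).integrable_mul (hL l _)).const_mul _
    rw [e, integral_finsetSum _ fun k _ => integrable_finsetSum _ fun l _ => hi k l]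
    simp_rw [integral_finsetSum _ fun l _ => hi _ l, integral_const_mul, hcov]
    rw [Finset.sum_mul]
    refine Finset.sum_congr rfl fun k _ => ?_
    rw [Finset.sum_eq_single k (fun l _ hl => by simp [hl.symm]) (by simp)]
    have : ((min s.toNNReal r.toNNReal : ℝ≥0) : ℝ) = min s r := by
      simp [hs, hr]
    rw [if_pos rfl, this]
    ring

/-! ### The weighted Laplacian -/

section Laplacian

variable {V : Type*} [Fintype V] [DecidableEq V] {G : SimpleGraph V} {w : Sym2 V → ℝ}

theorem weightedAdj_symm {V : Type*} (G : SimpleGraph V) (w : Sym2 V → ℝ) (i j : V) :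
    weightedAdj G w i j = weightedAdj G w j i := by
  simp only [weightedAdj, Matrix.of_apply, Sym2.eq_swap (a := i) (b := j)]
  by_cases h : G.Adj i j
  · rw [if_pos h, if_pos h.symm]
  · rw [if_neg h, if_neg (mt SimpleGraph.Adj.symm h)]

theorem laplacian_transpose (G : SimpleGraph V) (w : Sym2 V → ℝ) :
    (laplacian G w)ᵀ = laplacian G w := by
  have : (weightedAdj G w)ᵀ = weightedAdj G w := by
    ext i j
    exact weightedAdj_symm G w j i
  simp [laplacian, Matrix.transpose_sub, this]

theorem laplacian_mulVec (G : SimpleGraph V) (w : Sym2 V → ℝ) (v : V → ℝ) (i : V) :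
    (laplacian G w *ᵥ v) i = ∑ j, weightedAdj G w i j * (v i - v j) := by
  simp only [laplacian, Matrix.sub_mulVec, Pi.sub_apply, Matrix.mulVec_diagonal]
  simp only [Matrix.mulVec, dotProduct, Finset.sum_mul, mul_sub, Finset.sum_sub_distrib]

/-- The Dirichlet form, obtained by symmetrising in `i` and `j`. The factor `2` appears because
ordered pairs count each link twice. -/
theorem two_mul_dotProduct_laplacian (G : SimpleGraph V) (w : Sym2 V → ℝ) (v : V → ℝ) :
    2 * (v ⬝ᵥ (laplacian G w *ᵥ v)) = ∑ i, ∑ j, weightedAdj G w i j * (v i - v j) ^ 2 := by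
  have h1 : v ⬝ᵥ (laplacian G w *ᵥ v) = ∑ i, ∑ j, weightedAdj G w i j * (v i * (v i - v j)) := by
    simp only [dotProduct, laplacian_mulVec, Finset.mul_sum]
    exact Finset.sum_congr rfl fun i _ => Finset.sum_congr rfl fun j _ => by ring
  have h2 : v ⬝ᵥ (laplacian G w *ᵥ v) = ∑ i, ∑ j, weightedAdj G w i j * (v j * (v j - v i)) := by
    rw [h1, Finset.sum_comm]
    exact Finset.sum_congr rfl fun i _ => Finset.sum_congr rfl fun j _ => by
      rw [weightedAdj_symm]
  rw [two_mul]
  nth_rewrite 1 [h1]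
  rw [h2, ← Finset.sum_add_distrib]
  refine Finset.sum_congr rfl fun i _ => ?_
  rw [← Finset.sum_add_distrib]
  exact Finset.sum_congr rfl fun j _ => by ring

theorem weightedAdj_nonneg {V : Type*} {G : SimpleGraph V} {w : Sym2 V → ℝ}
    (hw : ∀ e ∈ G.edgeSet, 0 < w e) (i j : V) :
    0 ≤ weightedAdj G w i j := by
  simp only [weightedAdj, Matrix.of_apply]
  split_ifs with h
  · exact (hw _ (by simpa using h)).le
  · exact le_rfl

theorem dotProduct_laplacian_nonneg (hw : ∀ e ∈ G.edgeSet, 0 < w e) (v : V → ℝ) :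
    0 ≤ v ⬝ᵥ (laplacian G w *ᵥ v) := by
  have h := two_mul_dotProduct_laplacian G w v
  have : 0 ≤ ∑ i, ∑ j, weightedAdj G w i j * (v i - v j) ^ 2 :=
    Finset.sum_nonneg fun i _ => Finset.sum_nonneg fun j _ =>
      mul_nonneg (weightedAdj_nonneg hw i j) (sq_nonneg _)
  linarith

/-- The kernel of the Laplacian of a connected graph consists of the constant vectors. -/
theorem eq_of_laplacian_mulVec_eq_zero (hG : G.Connected) (hw : ∀ e ∈ G.edgeSet, 0 < w e)
    {v : V → ℝ} (hv : laplacian G w *ᵥ v = 0) (i j : V) : v i = v j := by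
  have h := two_mul_dotProduct_laplacian G w v
  rw [hv, dotProduct_zero, mul_zero] at h
  have hnn : ∀ i j, 0 ≤ weightedAdj G w i j * (v i - v j) ^ 2 := fun i j =>
    mul_nonneg (weightedAdj_nonneg hw i j) (sq_nonneg _)
  have hadj : ∀ a b, G.Adj a b → v a = v b := by
    intro a b hab
    have h1 := (Finset.sum_eq_zero_iff_of_nonneg fun i _ =>
      Finset.sum_nonneg fun j _ => hnn i j).1 h.symm a (Finset.mem_univ _)
    have h2 := (Finset.sum_eq_zero_iff_of_nonneg fun j _ => hnn a j).1 h1 b (Finset.mem_univ _)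
    have h3 : 0 < weightedAdj G w a b := by
      simp only [weightedAdj, Matrix.of_apply, if_pos hab]
      exact hw _ (by simpa using hab)
    have h4 := (mul_eq_zero.1 h2).resolve_left h3.ne'
    exact sub_eq_zero.1 (pow_eq_zero_iff two_ne_zero |>.1 h4)
  obtain ⟨p⟩ := hG.preconnected i j
  induction p with
  | nil => rfl
  | cons hab _ ih => exact (hadj _ _ hab).trans ih

theorem laplacian_mulVec_const (G : SimpleGraph V) (w : Sym2 V → ℝ) (c : ℝ) :
    laplacian G w *ᵥ (fun _ => c) = 0 := by
  funext i
  simp [laplacian_mulVec]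

end Laplacian

/-! ### Spectral calculus for the Laplacian -/

section Spectral

variable {V : Type*} [Fintype V] [DecidableEq V] {Q : Matrix V V ℝ}

theorem conj_diagonal_mul (hQ : Qᵀ * Q = 1) (a b : V → ℝ) :
    (Q * Matrix.diagonal a * Qᵀ) * (Q * Matrix.diagonal b * Qᵀ)
      = Q * Matrix.diagonal (fun i => a i * b i) * Qᵀ := by
  calc (Q * Matrix.diagonal a * Qᵀ) * (Q * Matrix.diagonal b * Qᵀ)
      = Q * Matrix.diagonal a * (Qᵀ * Q) * Matrix.diagonal b * Qᵀ := by
        simp only [Matrix.mul_assoc]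
    _ = _ := by
        rw [hQ, Matrix.mul_one, Matrix.mul_assoc Q, Matrix.diagonal_mul_diagonal]

theorem conj_diagonal_pow (hQ : Qᵀ * Q = 1) (a : V → ℝ) (k : ℕ) :
    (Q * Matrix.diagonal a * Qᵀ) ^ k = Q * Matrix.diagonal (fun i => a i ^ k) * Qᵀ := by
  induction k with
  | zero =>
    have h1 : Matrix.diagonal (fun _ : V => (1 : ℝ)) = 1 := Matrix.diagonal_one
    simp only [pow_zero, h1, Matrix.mul_one]
    exact (mul_eq_one_comm.1 hQ).symm
  | succ k ih =>
    rw [pow_succ, ih, conj_diagonal_mul hQ]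
    simp only [pow_succ]

theorem hasSum_conj_diagonal (Q : Matrix V V ℝ) {f : ℕ → V → ℝ} {d : V → ℝ}
    (hf : ∀ i, HasSum (fun k => f k i) (d i)) :
    HasSum (fun k => Q * Matrix.diagonal (f k) * Qᵀ) (Q * Matrix.diagonal d * Qᵀ) := by
  have h := (Pi.hasSum.2 hf).map (g := (((AddMonoidHom.mulRight Qᵀ).comp
    (AddMonoidHom.mulLeft Q)).comp (Matrix.diagonalAddMonoidHom V ℝ)))
    (by
      change Continuous fun d : V → ℝ => Q * Matrix.diagonal d * Qᵀ
      fun_prop)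
  exact h

theorem matCos_conj_diagonal (hQ : Qᵀ * Q = 1) (a : V → ℝ) :
    matCos (Q * Matrix.diagonal a * Qᵀ)
      = Q * Matrix.diagonal (fun i => Real.cos (a i)) * Qᵀ := by
  have h := hasSum_conj_diagonal Q fun i => Real.hasSum_cos (a i)
  rw [matCos, ← h.tsum_eq]
  congr 1
  funext k
  rw [conj_diagonal_pow hQ, ← Matrix.smul_mul, ← Matrix.mul_smul, ← Matrix.diagonal_smul]
  congr 3
  funext i
  simp only [Pi.smul_apply, smul_eq_mul]
  ring

theorem matSin_conj_diagonal (hQ : Qᵀ * Q = 1) (a : V → ℝ) :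
    matSin (Q * Matrix.diagonal a * Qᵀ)
      = Q * Matrix.diagonal (fun i => Real.sin (a i)) * Qᵀ := by
  have h := hasSum_conj_diagonal Q fun i => Real.hasSum_sin (a i)
  rw [matSin, ← h.tsum_eq]
  congr 1
  funext k
  rw [conj_diagonal_pow hQ, ← Matrix.smul_mul, ← Matrix.mul_smul, ← Matrix.diagonal_smul]
  congr 3
  funext i
  simp only [Pi.smul_apply, smul_eq_mul]
  ring

variable {G : SimpleGraph V} {w : Sym2 V → ℝ} {lam : V → ℝ}

theorem laplacian_mulVec_col (hQ : Qᵀ * Q = 1)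
    (hL : laplacian G w = Q * Matrix.diagonal lam * Qᵀ) (i : V) :
    laplacian G w *ᵥ Q.col i = lam i • Q.col i := by
  have h : laplacian G w * Q = Q * Matrix.diagonal lam := by
    rw [hL, Matrix.mul_assoc, hQ, Matrix.mul_one]
  funext j
  have := congrFun (congrFun h j) i
  rw [Matrix.mul_diagonal] at this
  simpa [Matrix.mul_apply, Matrix.mulVec, dotProduct, Matrix.col_apply, mul_comm] using this

theorem col_dotProduct_col (hQ : Qᵀ * Q = 1) (i : V) : Q.col i ⬝ᵥ Q.col i = 1 := by
  have := congrFun (congrFun hQ i) i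
  simpa [Matrix.mul_apply, dotProduct, Matrix.col_apply] using this

theorem laplacian_eigenvalue_nonneg (hw : ∀ e ∈ G.edgeSet, 0 < w e) (hQ : Qᵀ * Q = 1)
    (hL : laplacian G w = Q * Matrix.diagonal lam * Qᵀ) (i : V) : 0 ≤ lam i := by
  have := dotProduct_laplacian_nonneg hw (Q.col i)
  rwa [laplacian_mulVec_col hQ hL, dotProduct_smul, col_dotProduct_col hQ, smul_eq_mul,
    mul_one] at this

/-- Lets the stability condition, stated for eigenvalues, apply to the entries of any
diagonalisation. -/
theorem hasEigenvalue_laplacian (hQ : Qᵀ * Q = 1)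
    (hL : laplacian G w = Q * Matrix.diagonal lam * Qᵀ) (i : V) :
    Module.End.HasEigenvalue (Matrix.toLin' (laplacian G w)) (lam i) := by
  refine Module.End.hasEigenvalue_of_hasEigenvector (x := Q.col i)
    ⟨Module.End.mem_eigenspace_iff.2 ?_, fun h => ?_⟩
  · rw [Matrix.toLin'_apply, laplacian_mulVec_col hQ hL]
  · have := col_dotProduct_col hQ i
    rw [h, dotProduct_zero] at this
    exact zero_ne_one this

/-- The centering matrix is the orthogonal projection onto the range of the Laplacian. -/
theorem centering_eq (hG : G.Connected) (hw : ∀ e ∈ G.edgeSet, 0 < w e) (hQ : Qᵀ * Q = 1)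
    (hL : laplacian G w = Q * Matrix.diagonal lam * Qᵀ) :
    centering V = Q * Matrix.diagonal (fun i => if lam i = 0 then 0 else 1) * Qᵀ := by
  have : Nonempty V := hG.nonempty
  set d : V → ℝ := fun i => if lam i = 0 then 0 else 1 with hd
  set E := Q * Matrix.diagonal d * Qᵀ with hE
  set J : Matrix V V ℝ := Matrix.of fun _ _ => 1 with hJ
  have hn : (Fintype.card V : ℝ) ≠ 0 := by exact_mod_cast Fintype.card_ne_zero
  have hLJ : laplacian G w * J = 0 := by
    ext i j
    have := congrFun (laplacian_mulVec_const G w 1) i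
    simpa [Matrix.mul_apply, Matrix.mulVec, dotProduct, hJ] using this
  have hJJ : J * J = (Fintype.card V : ℝ) • J := by
    ext i j
    simp [Matrix.mul_apply, hJ]
  have hJM : J * centering V = 0 := by
    rw [centering, ← hJ, Matrix.mul_sub, Matrix.mul_one, Matrix.mul_smul, hJJ, smul_smul,
      one_div_mul_cancel hn, one_smul, sub_self]
  -- With `M` the centering matrix, `E M = E` because `E = L† L` and `L` kills `J`. The other half
  -- is `(1 - E) M = 0`; together they give `M = E` without counting the multiplicity of the
  -- eigenvalue `0`.
  have hEM : E * centering V = E := by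
    have h1 : E = Q * Matrix.diagonal (fun i => (lam i)⁻¹) * Qᵀ * laplacian G w := by
      rw [hL, conj_diagonal_mul hQ, hE, hd]
      congr 3
      funext i
      by_cases h : lam i = 0 <;> simp [h]
    have h2 : laplacian G w * centering V = laplacian G w := by
      rw [centering, ← hJ, Matrix.mul_sub, Matrix.mul_one, Matrix.mul_smul, hLJ, smul_zero,
        sub_zero]
    rw [h1, Matrix.mul_assoc, h2]
  have hLE : laplacian G w * (1 - E) = 0 := by
    rw [Matrix.mul_sub, Matrix.mul_one, hL, hE, conj_diagonal_mul hQ, sub_eq_zero]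
    congr 3
    funext i
    by_cases h : lam i = 0 <;> simp [hd, h]
  have hEs : (1 - E)ᵀ = 1 - E := by
    simp [hE, Matrix.transpose_mul, Matrix.mul_assoc]
  -- The columns of `1 - E` lie in the kernel of `L`, so they are constant; by symmetry `1 - E` is a
  -- multiple of `J`.
  have hconst : ∀ i i' j, (1 - E) i j = (1 - E) i' j := fun i i' j => by
    refine eq_of_laplacian_mulVec_eq_zero hG hw (v := fun k => (1 - E) k j) ?_ i i'
    funext k
    exact congrFun (congrFun hLE k) j
  have hsymm : ∀ i j, (1 - E) i j = (1 - E) j i := fun i j => congrFun (congrFun hEs j) i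
  obtain ⟨i₀⟩ := this
  have hEJ : 1 - E = ((1 - E) i₀ i₀) • J := by
    ext i j
    rw [hconst i i₀ j, hsymm i₀ j, hconst j i₀ i₀]
    simp [hJ]
  have h0 : (1 - E) * centering V = 0 := by
    rw [hEJ, Matrix.smul_mul, hJM, smul_zero]
  rw [Matrix.sub_mul, Matrix.one_mul, hEM, sub_eq_zero] at h0
  exact h0

theorem pinv_conj_diagonal (hQ : Qᵀ * Q = 1) (a : V → ℝ) :
    pinv (Q * Matrix.diagonal a * Qᵀ) = Q * Matrix.diagonal (fun i => (a i)⁻¹) * Qᵀ :=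
  (pinv_spec _).unique (isMoorePenrose_of_diag Q a hQ)

/-- All the factors are diagonal in the same basis. On a nonzero mode centering contributes the `1`
in `1 - sin`; on a zero mode the convention `0⁻¹ = 0` is precisely the pseudo-inverse. -/
theorem centralityIndex_eq {ι : Type*} (hG : G.Connected) (hw : ∀ e ∈ G.edgeSet, 0 < w e)
    (hQ : Qᵀ * Q = 1) (hL : laplacian G w = Q * Matrix.diagonal lam * Qᵀ) (τ : ℝ)
    (B : Matrix V ι ℝ) (k : ι) :
    centralityIndex (laplacian G w) τ B k = ∑ i with lam i ≠ 0,
      (Qᵀ * B) i k ^ 2 * (Real.cos (lam i * τ) / (2 * lam i * (1 - Real.sin (lam i * τ)))) := by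
  have hτL : τ • laplacian G w = Q * Matrix.diagonal (fun i => lam i * τ) * Qᵀ := by
    rw [hL, ← Matrix.smul_mul, ← Matrix.mul_smul, ← Matrix.diagonal_smul]
    congr 3
    funext i
    simp [mul_comm]
  have hsub : centering V - matSin (τ • laplacian G w)
      = Q * Matrix.diagonal (fun i => (if lam i = 0 then 0 else 1) - Real.sin (lam i * τ)) * Qᵀ := by
    rw [hτL, matSin_conj_diagonal hQ, centering_eq hG hw hQ hL, ← Matrix.sub_mul,
      ← Matrix.mul_sub, Matrix.diagonal_sub]
  rw [centralityIndex, hsub, pinv_conj_diagonal hQ, hτL, matCos_conj_diagonal hQ, hL,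
    pinv_conj_diagonal hQ, Matrix.mul_assoc Bᵀ, conj_diagonal_mul hQ, Matrix.mul_assoc Bᵀ,
    conj_diagonal_mul hQ]
  set d : V → ℝ := fun i => (lam i)⁻¹ * Real.cos (lam i * τ)
    * ((if lam i = 0 then 0 else 1) - Real.sin (lam i * τ))⁻¹ with hd
  have e : Bᵀ * (Q * Matrix.diagonal d * Qᵀ) * B
      = (Qᵀ * B)ᵀ * Matrix.diagonal d * (Qᵀ * B) := by
    simp [Matrix.transpose_mul, Matrix.mul_assoc]
  rw [e, Matrix.mul_apply, Finset.mul_sum, Finset.sum_filter]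
  refine Finset.sum_congr rfl fun i _ => ?_
  rw [Matrix.mul_diagonal, Matrix.transpose_apply]
  by_cases h : lam i = 0
  · simp [hd, h]
  · simp only [hd, h, if_false, ne_eq, not_false_eq_true, if_true, div_eq_mul_inv, mul_inv]
    ring

end Spectral

/-! ### The network in modal coordinates -/

section Network

variable {V ι Ω : Type*} [Fintype V] [DecidableEq V] [Fintype ι] [MeasurableSpace Ω]
  {P : Measure Ω} {G : SimpleGraph V} {w : Sym2 V → ℝ} {τ : ℝ} {B : Matrix V ι ℝ}
  {x₀ : V → ℝ} {W : ι → ℝ≥0 → Ω → ℝ} {σ : ι → ℝ} {X : ℝ → Ω → V → ℝ} {Q : Matrix V V ℝ}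
  {lam : V → ℝ}

/-- The `i`-th modal coordinate of the state, extended by zero to negative times. -/
noncomputable def mode (Q : Matrix V V ℝ) (X : ℝ → Ω → V → ℝ) (i : V) (t : ℝ) (ω : Ω) : ℝ :=
  if 0 ≤ t then (Qᵀ *ᵥ X t ω) i else 0

theorem transpose_mulVec_laplacian (hQ : Qᵀ * Q = 1)
    (hL : laplacian G w = Q * Matrix.diagonal lam * Qᵀ) (v : V → ℝ) (i : V) :
    (Qᵀ *ᵥ (laplacian G w *ᵥ v)) i = lam i * (Qᵀ *ᵥ v) i := by
  rw [Matrix.mulVec_mulVec, hL, ← Matrix.mul_assoc, ← Matrix.mul_assoc, hQ, Matrix.one_mul,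
    ← Matrix.mulVec_mulVec, Matrix.mulVec_diagonal]

theorem IsNetworkState.isCausal_mode
    (hX : IsNetworkState (laplacian G w) τ B σ x₀ W P X) (i : V) :
    ∀ᵐ ω ∂P, IsCausal fun t => mode Q X i t ω := by
  filter_upwards [hX.continuousOn] with ω hω
  refine ⟨fun t ht => if_neg (not_le.2 ht), ?_⟩
  have hc : ContinuousOn (fun t => (Qᵀ *ᵥ X t ω) i) (Set.Ici 0) := by
    simp only [Matrix.mulVec, dotProduct]
    exact continuousOn_finsetSum _ fun j _ =>
      continuousOn_const.mul (continuousOn_pi.1 hω j)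
  exact hc.congr fun t ht => if_pos ht

theorem IsNetworkState.mode_equation (hQ : Qᵀ * Q = 1)
    (hL : laplacian G w = Q * Matrix.diagonal lam * Qᵀ)
    (hX : IsNetworkState (laplacian G w) τ B σ x₀ W P X) (i : V) :
    ∀ᵐ ω ∂P, ∀ t, 0 ≤ t → mode Q X i t ω = (Qᵀ *ᵥ x₀) i
      - lam i * (∫ s in (0 : ℝ)..t, mode Q X i (s - τ) ω)
      + ∑ k, ((Qᵀ * B) i k * σ k) * W k t.toNNReal ω := by
  filter_upwards [hX.history, hX.continuousOn, hX.equation] with ω hhist hcont heq t ht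
  have hcausal : ∀ j, IsCausal fun t => if 0 ≤ t then (laplacian G w *ᵥ X t ω) j else 0 := by
    refine fun j => ⟨fun t ht => if_neg (not_le.2 ht), ?_⟩
    have hc : ContinuousOn (fun t => (laplacian G w *ᵥ X t ω) j) (Set.Ici 0) := by
      simp only [Matrix.mulVec, dotProduct]
      exact continuousOn_finsetSum _ fun j _ =>
        continuousOn_const.mul (continuousOn_pi.1 hcont j)
    exact hc.congr fun t ht => if_pos ht
  -- For `s < τ` the delayed time lies in `[-τ, 0)`, where the history vanishes; extending by zero
  -- changes nothing.
  have hext : ∀ j, ∫ s in (0 : ℝ)..t, (laplacian G w *ᵥ X (s - τ) ω) j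
      = ∫ s in (0 : ℝ)..t, if 0 ≤ s - τ then (laplacian G w *ᵥ X (s - τ) ω) j else 0 := by
    refine fun j => intervalIntegral.integral_congr fun s hs => ?_
    rw [Set.uIcc_of_le ht] at hs
    by_cases h : 0 ≤ s - τ
    · simp only [if_pos h]
    · simp only [if_neg h]
      rw [hhist (s - τ) ⟨by linarith [hs.1], not_le.1 h⟩, Matrix.mulVec_zero, Pi.zero_apply]
  have hdrift : ∑ j, Q j i * ∫ s in (0 : ℝ)..t, (laplacian G w *ᵥ X (s - τ) ω) j
      = lam i * ∫ s in (0 : ℝ)..t, mode Q X i (s - τ) ω := by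
    simp_rw [hext, ← intervalIntegral.integral_const_mul]
    rw [← intervalIntegral.integral_finsetSum fun j _ =>
      ((hcausal j).intervalIntegrable_comp_sub τ 0 t).const_mul (Q j i)]
    refine intervalIntegral.integral_congr fun s _ => ?_
    by_cases h : 0 ≤ s - τ
    · simp only [mode, if_pos h]
      rw [← transpose_mulVec_laplacian hQ hL]
      simp [Matrix.mulVec, dotProduct]
    · simp only [mode, if_neg h, mul_zero, Finset.sum_const_zero]
  have hnoise : ∑ j, Q j i * (B *ᵥ fun k => σ k * W k t.toNNReal ω) j
      = ∑ k, ((Qᵀ * B) i k * σ k) * W k t.toNNReal ω := by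
    have : ∑ j, Q j i * (B *ᵥ fun k => σ k * W k t.toNNReal ω) j
        = (Qᵀ *ᵥ (B *ᵥ fun k => σ k * W k t.toNNReal ω)) i := by
      simp [Matrix.mulVec, dotProduct]
    rw [this, Matrix.mulVec_mulVec]
    simp only [Matrix.mulVec, dotProduct, mul_assoc]
  have hinit : ∑ j, Q j i * x₀ j = (Qᵀ *ᵥ x₀) i := by
    simp [Matrix.mulVec, dotProduct]
  rw [← hdrift, ← hnoise, ← hinit, ← Finset.sum_sub_distrib, ← Finset.sum_add_distrib, mode,
    if_pos ht]
  simp only [Matrix.mulVec, dotProduct, Matrix.transpose_apply]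
  refine Finset.sum_congr rfl fun j _ => ?_
  rw [heq t ht j]
  simp only [Matrix.mulVec, dotProduct]
  ring

/-- Parseval: centering projects onto the nonzero modes and `Q` is an isometry. -/
theorem outputSq_eq {Ω : Type*} (hG : G.Connected) (hw : ∀ e ∈ G.edgeSet, 0 < w e) (hQ : Qᵀ * Q = 1)
    (hL : laplacian G w = Q * Matrix.diagonal lam * Qᵀ) (X : ℝ → Ω → V → ℝ) {t : ℝ}
    (ht : 0 ≤ t) (ω : Ω) :
    outputSq X t ω = ∑ i with lam i ≠ 0, mode Q X i t ω ^ 2 := by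
  have hiso : ∀ v : V → ℝ, (Q *ᵥ v) ⬝ᵥ (Q *ᵥ v) = v ⬝ᵥ v := fun v => by
    rw [Matrix.dotProduct_mulVec, Matrix.vecMul_mulVec, hQ, Matrix.vecMul_one]
  rw [outputSq, centering_eq hG hw hQ hL, Matrix.mul_assoc, ← Matrix.mulVec_mulVec, hiso,
    ← Matrix.mulVec_mulVec, dotProduct, Finset.sum_filter]
  refine Finset.sum_congr rfl fun i _ => ?_
  rw [Matrix.mulVec_diagonal, mode, if_pos ht]
  by_cases h : lam i = 0
  · simp [h]
  · simp [h, sq]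

/-- The mean squared output converges to the sum of the contributions of the nonzero modes. -/
theorem IsNetworkState.tendsto_outputSq [IsProbabilityMeasure P] (hG : G.Connected)
    (hw : ∀ e ∈ G.edgeSet, 0 < w e) (hτ : 0 ≤ τ)
    (hstab : ∀ μ : ℝ, Module.End.HasEigenvalue (Matrix.toLin' (laplacian G w)) μ →
      τ * μ < Real.pi / 2)
    (hW : IsIndepBrownian W P) (hQ : Qᵀ * Q = 1)
    (hL : laplacian G w = Q * Matrix.diagonal lam * Qᵀ)
    (hX : IsNetworkState (laplacian G w) τ B σ x₀ W P X) :
    (∀ t : ℝ, 0 ≤ t → Integrable (outputSq X t) P) ∧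
    Tendsto (fun t : ℝ => ∫ ω, outputSq X t ω ∂P) atTop (𝓝 (∑ i with lam i ≠ 0,
      (∑ k, ((Qᵀ * B) i k * σ k) ^ 2)
        * (Real.cos (lam i * τ) / (2 * lam i * (1 - Real.sin (lam i * τ)))))) := by
  choose φ hφ using fun i => exists_isFundamental (lam i) hτ
  have hmode := fun i t (ht : (0 : ℝ) ≤ t) =>
    (hW.isBrownianLike_sum fun k => (Qᵀ * B) i k * σ k).secondMoment hτ (hφ i)
      (z := mode Q X i) (hX.isCausal_mode i) (hX.mode_equation hQ hL i) ht
  have hout : ∀ t, 0 ≤ t → outputSq X t = fun ω => ∑ i with lam i ≠ 0, mode Q X i t ω ^ 2 :=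
    fun t ht => funext fun ω => outputSq_eq hG hw hQ hL X ht ω
  refine ⟨fun t ht => ?_, ?_⟩
  · rw [hout t ht]
    exact integrable_finsetSum _ fun i _ => (hmode i t ht).1
  -- The contribution of the initial state dies with `φ`. Discarding the zero modes is essential,
  -- since there `φ = 1` and `∫₀ᵗ φ²` grows linearly.
  · have hlim : ∀ i ∈ Finset.univ.filter (fun i => lam i ≠ 0),
        Tendsto (fun t => φ i t ^ 2 * (Qᵀ *ᵥ x₀) i ^ 2
          + (∑ k, ((Qᵀ * B) i k * σ k) ^ 2) * ∫ s in (0 : ℝ)..t, φ i s ^ 2) atTop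
        (𝓝 ((∑ k, ((Qᵀ * B) i k * σ k) ^ 2)
          * (Real.cos (lam i * τ) / (2 * lam i * (1 - Real.sin (lam i * τ)))))) := by
      intro i hi
      have hpos : 0 < lam i :=
        lt_of_le_of_ne (laplacian_eigenvalue_nonneg hw hQ hL i) (Finset.mem_filter.1 hi).2.symm
      obtain ⟨h1, h2⟩ := (hφ i).tendsto hpos hτ (hstab _ (hasEigenvalue_laplacian hQ hL i))
      simpa using ((h1.pow 2).mul_const ((Qᵀ *ᵥ x₀) i ^ 2)).add
        (h2.const_mul (∑ k, ((Qᵀ * B) i k * σ k) ^ 2))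
    refine (tendsto_finsetSum _ hlim).congr' ?_
    filter_upwards [eventually_ge_atTop 0] with t ht
    rw [hout t ht, integral_finsetSum _ fun i _ => (hmode i t ht).1]
    exact Finset.sum_congr rfl fun i _ => (hmode i t ht).2.symm

end Network

/-! ### Assembly of the performance formula and the centralities -/

theorem exists_orthogonal_diagonalization {V : Type*} [Fintype V] [DecidableEq V]
    {L : Matrix V V ℝ} (hL : Lᵀ = L) :
    ∃ (Q : Matrix V V ℝ) (lam : V → ℝ), Qᵀ * Q = 1 ∧ L = Q * Matrix.diagonal lam * Qᵀ := by
  have hS : L.IsHermitian := by simpa [Matrix.IsHermitian] using hL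
  refine ⟨hS.eigenvectorUnitary, hS.eigenvalues, ?_, ?_⟩
  · simpa [Matrix.star_eq_conjTranspose] using
      Matrix.mem_unitaryGroup_iff'.1 hS.eigenvectorUnitary.2
  · have h := hS.spectral_theorem
    rw [Unitary.conjStarAlgAut_apply] at h
    simpa [Matrix.star_eq_conjTranspose, Function.comp_def] using h

end DelayConsensus

/-- The noise channels are indexed by an arbitrary finite type `ι`: node noise is `ι = V`,
link noise is `ι = G.edgeSet`. -/
theorem theorem2 {V ι Ω : Type*} [Fintype V] [DecidableEq V] [Fintype ι] [DecidableEq ι]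
    [MeasurableSpace Ω] (P : Measure Ω) [IsProbabilityMeasure P]
    (G : SimpleGraph V) (hG : G.Connected)
    (w : Sym2 V → ℝ) (hw : ∀ e ∈ G.edgeSet, 0 < w e)
    (τ : ℝ) (hτ : 0 ≤ τ)
    (hstab : ∀ μ : ℝ, Module.End.HasEigenvalue
      (Matrix.toLin' (DelayConsensus.laplacian G w)) μ → τ * μ < Real.pi / 2)
    (B : Matrix V ι ℝ) (x₀ : V → ℝ)
    (W : ι → ℝ≥0 → Ω → ℝ) (hW : DelayConsensus.IsIndepBrownian W P)
    (X : (ι → ℝ) → ℝ → Ω → V → ℝ)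
    (hX : ∀ σ : ι → ℝ, (∀ k, 0 ≤ σ k) →
      DelayConsensus.IsNetworkState (DelayConsensus.laplacian G w) τ B σ x₀ W P (X σ)) :
    -- the limit defining the performance exists and is the weighted sum of the indices
    (∀ σ : ι → ℝ, (∀ k, 0 ≤ σ k) →
      (∀ t : ℝ, 0 ≤ t → Integrable (DelayConsensus.outputSq (X σ) t) P) ∧
      Tendsto (fun t : ℝ => ∫ ω, DelayConsensus.outputSq (X σ) t ω ∂P) atTop
        (𝓝 (DelayConsensus.rhoSS P (X σ))) ∧
      DelayConsensus.rhoSS P (X σ)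
        = ∑ k, DelayConsensus.centralityIndex (DelayConsensus.laplacian G w) τ B k * σ k ^ 2) ∧
    -- the indices are the centralities of the noise channels
    (∀ (k : ι) (σ : ι → ℝ), (∀ l, 0 ≤ σ l) →
      DelayConsensus.HasCentrality (fun σ' => DelayConsensus.rhoSS P (X σ')) k σ
        (DelayConsensus.centralityIndex (DelayConsensus.laplacian G w) τ B k)) ∧
    -- the modal form, for every orthogonal diagonalisation of the Laplacian
    (∀ (Q : Matrix V V ℝ) (lam : V → ℝ), Qᵀ * Q = 1 →
      DelayConsensus.laplacian G w = Q * Matrix.diagonal lam * Qᵀ →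
      ∀ σ : ι → ℝ, (∀ k, 0 ≤ σ k) →
        DelayConsensus.rhoSS P (X σ) = ∑ i with lam i ≠ 0,
          (Qᵀ * (B * Matrix.diagonal σ) * (B * Matrix.diagonal σ)ᵀ * Q) i i
            * Real.cos (lam i * τ) / (2 * lam i * (1 - Real.sin (lam i * τ)))) := by
  obtain ⟨Q, lam, hQ, hL⟩ := DelayConsensus.exists_orthogonal_diagonalization
    (DelayConsensus.laplacian_transpose G w)
  -- Kept general in `Q`: one fixed diagonalisation serves the indices, an arbitrary one the modal
  -- form.
  have hlim := fun (Q : Matrix V V ℝ) (lam : V → ℝ) (hQ : Qᵀ * Q = 1)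
      (hL : DelayConsensus.laplacian G w = Q * Matrix.diagonal lam * Qᵀ)
      (σ : ι → ℝ) (hσ : ∀ k, 0 ≤ σ k) =>
    (hX σ hσ).tendsto_outputSq hG hw hτ hstab hW hQ hL
  have hrho : ∀ σ : ι → ℝ, (∀ k, 0 ≤ σ k) → DelayConsensus.rhoSS P (X σ)
      = ∑ k, DelayConsensus.centralityIndex (DelayConsensus.laplacian G w) τ B k * σ k ^ 2 := by
    intro σ hσ
    rw [DelayConsensus.rhoSS, (hlim Q lam hQ hL σ hσ).2.limUnder_eq]
    simp_rw [DelayConsensus.centralityIndex_eq hG hw hQ hL, Finset.sum_mul]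
    rw [Finset.sum_comm]
    refine Finset.sum_congr rfl fun i _ => Finset.sum_congr rfl fun k _ => ?_
    ring
  refine ⟨fun σ hσ => ⟨(hlim Q lam hQ hL σ hσ).1,
    tendsto_nhds_limUnder ⟨_, (hlim Q lam hQ hL σ hσ).2⟩, hrho σ hσ⟩, ?_, ?_⟩
  · intro k σ hσ
    set η := DelayConsensus.centralityIndex (DelayConsensus.laplacian G w) τ B with hη
    -- By `hrho` the performance depends on the noise levels only, whichever states are chosen. As a
    -- function of the variance `v = σₖ²` it is affine with slope `η k` on `[0, ∞)`, hence the
    -- one-sided derivative at `0`.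
    have hval : ∀ v ∈ Set.Ici (0 : ℝ),
        DelayConsensus.rhoSS P (X (Function.update σ k (Real.sqrt v)))
          = η k * v + ∑ l ∈ Finset.univ.erase k, η l * σ l ^ 2 := by
      intro v hv
      rw [hrho, ← Finset.add_sum_erase _ _ (Finset.mem_univ k), Function.update_self,
        Real.sq_sqrt hv]
      · refine congrArg _ (Finset.sum_congr rfl fun l hl => ?_)
        rw [Function.update_of_ne (Finset.ne_of_mem_erase hl)]
      · intro l
        by_cases h : l = k
        · subst h
          rw [Function.update_self]
          exact Real.sqrt_nonneg v
        · rw [Function.update_of_ne h]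
          exact hσ l
    have hd : HasDerivAt (fun v : ℝ => η k * v + ∑ l ∈ Finset.univ.erase k, η l * σ l ^ 2)
        (η k) (σ k ^ 2) := by
      simpa using ((hasDerivAt_id (σ k ^ 2)).const_mul (η k)).add_const
        (∑ l ∈ Finset.univ.erase k, η l * σ l ^ 2)
    exact hd.hasDerivWithinAt.congr hval (hval _ (Set.mem_Ici.2 (sq_nonneg _)))
  · intro Q lam hQ hL σ hσ
    rw [DelayConsensus.rhoSS, (hlim Q lam hQ hL σ hσ).2.limUnder_eq]
    refine Finset.sum_congr rfl fun i _ => ?_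
    have : (Qᵀ * (B * Matrix.diagonal σ) * (B * Matrix.diagonal σ)ᵀ * Q) i i
        = ∑ k, ((Qᵀ * B) i k * σ k) ^ 2 := by
      have e : Qᵀ * (B * Matrix.diagonal σ) * (B * Matrix.diagonal σ)ᵀ * Q
          = (Qᵀ * B * Matrix.diagonal σ) * (Qᵀ * B * Matrix.diagonal σ)ᵀ := by
        simp [Matrix.transpose_mul, Matrix.mul_assoc]
      rw [e, Matrix.mul_apply]
      refine Finset.sum_congr rfl fun k _ => ?_
      rw [Matrix.transpose_apply, Matrix.mul_diagonal, sq]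
    rw [this, mul_div_assoc]
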